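/- Let $s\in(\tfrac14,\tfrac12]$ and let $K:\mathbb R\to\mathbb R$ be a measurable even kernel with $$\frac{\theta_0}{|r|^{1+2s}}\,\chi_{[0,r_0]}(r)\le K(r)\le\frac{\Theta_0}{|r|^{1+2s}}\qquad(r\ne0)$$ for some $\Theta_0\ge\theta_0>0$ and $r_0>0$, and set $$\mathcal L Q(x):=\mathrm{P.V.}\int_{\mathbb R}(Q(x)-Q(y))K(x-y)\,dy=\lim_{\varrho\searrow0}\int_{\{|x-y|\ge\varrho\}}(Q(x)-Q(y))K(x-y)\,dy .$$ Let $\zeta_1,\zeta_2\in\mathbb R$ and $r>0$. Let $Q^\sharp\in C^\infty(\mathbb R)$ take values in $[\min\{\zeta_1,\zeta_2\},\max\{\zeta_1,\zeta_2\}]$, with $Q^\sharp=\zeta_1$ on $(-\infty,-1)$ and $Q^\sharp=\zeta_2$ on $(1,+\infty)$. Let the obstacles $\Phi,\Psi\in C^\infty(\mathbb R)$ be such that $\Phi=\zeta_1+r$ and $\Psi=\zeta_1-r$ near $-\infty$, and $\Phi=\zeta_2+r$ and $\Psi=\zeta_2-r$ near $+\infty$. Let $$\Sigma:=\{Q:\mathbb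 R\to\mathbb R\ :\ Q-Q^\sharp\in H^1(\mathbb R)\text{ and }\Psi(x)\le Q(x)\le\Phi(x)\text{ for all }x\in\mathbb R\}.$$ Let $\eta\in(0,1]$, let $I\subset\mathbb R$ be a bounded interval and $f\in L^\infty(I)$. Let $u\in\Sigma$ and assume that $$\eta\int_{\mathbb R}\dot u\,(\dot u-\dot v)\,dx+\frac12\iint_{\mathbb R^2}(u(x)-u(y))\big((u-v)(x)-(u-v)(y)\big)K(x-y)\,dx\,dy\le\int_{\mathbb R}f\,(u-v)\,dx$$ for every $v\in\Sigma$ with $v=u$ in $\mathbb R\setminus I$. Then $\mathcal L\Phi$ and $\mathcal L\Psi$ are well defined in $I$, the function $-|\ddot\Phi|+\mathcal L\Phi$ is bounded from below in $I$, the function $|\ddot\Psi|+\mathcal L\Psi$ is bounded from above in $I$, and, in the sense of distributions in (the interior of) $I$, $$\min\Big\{\inf_{x\in I}\big(-|\ddot\Phi(x)|+\mathcal L\Phi(x)\big),\ \inf_I f\Big\}\le-\eta\ddot u+\mathcal L u\le\max\Big\{\sup_{x\in I}\big(|\ddot\Psi(x)|+\mathcal L\Psi(x)\big),\ \sup_I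 f\Big\},$$ where $\inf_I f$ and $\sup_I f$ are the essential infimum and supremum. That is, denoting by $m$ and $M$ the left-hand and the right-hand side, for every nonnegative $\varphi\in C^\infty_c(\mathrm{int}\,I)$, $$m\int_{\mathbb R}\varphi\,dx\le-\eta\int_{\mathbb R}u\,\ddot\varphi\,dx+\int_{\mathbb R}u\,\mathcal L\varphi\,dx\le M\int_{\mathbb R}\varphi\,dx$$ (for every $\varphi\in C^\infty_c(\mathrm{int}\,I)$, $\mathcal L\varphi$ is defined everywhere and $u\,\mathcal L\varphi$ is integrable). The bounds $m$ and $M$ do not involve $\eta$ explicitly. -/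

import Mathlib

open MeasureTheory Set Filter Topology
open scoped ContDiff ENNReal

noncomputable section

namespace MixedObstacle

/-- The assumptions on the interaction kernel `K`: it is even and
`θ₀ |r|^{-1-2s} χ_{[0,r₀]}(r) ≤ K(r) ≤ Θ₀ |r|^{-1-2s}` for `r ≠ 0`, where `Θ₀ ≥ θ₀ > 0` and `r₀ > 0`. -/
structure IsKernel (s θ₀ Θ₀ r₀ : ℝ) (K : ℝ → ℝ) : Prop where
  theta_pos : 0 < θ₀
  theta_le : θ₀ ≤ Θ₀
  radius_pos : 0 < r₀
  measurable : Measurable K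
  even : ∀ r, K (-r) = K r
  lower : ∀ r, r ≠ 0 → (Icc 0 r₀).indicator (fun t => θ₀ / |t| ^ (1 + 2 * s)) r ≤ K r
  upper : ∀ r, r ≠ 0 → K r ≤ Θ₀ / |r| ^ (1 + 2 * s)

/-- The truncated integral `∫_{ℝ ∖ B_ϱ(x)} (Q(x) - Q(y)) K(x - y) dy`. -/
def truncatedOp (K Q : ℝ → ℝ) (x ϱ : ℝ) : ℝ :=
  ∫ y in (Metric.ball x ϱ)ᶜ, (Q x - Q y) * K (x - y)

/-- The principal value defining `𝓛 Q (x)` exists (as a finite limit). -/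
def HasPrincipalValue (K Q : ℝ → ℝ) (x : ℝ) : Prop :=
  ∃ l : ℝ, Tendsto (truncatedOp K Q x) (𝓝[>] 0) (𝓝 l)

/-- The nonlocal operator
`𝓛 Q (x) = P.V. ∫ (Q(x) - Q(y)) K(x - y) dy = lim_{ϱ ↘ 0} ∫_{ℝ ∖ B_ϱ(x)} (Q(x) - Q(y)) K(x - y) dy`. -/
def nonlocalOp (K Q : ℝ → ℝ) (x : ℝ) : ℝ :=
  limUnder (𝓝[>] 0) (truncatedOp K Q x)

/-- `g'` is a weak (distributional) derivative of `g` on `ℝ`. -/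
def HasWeakDeriv (g g' : ℝ → ℝ) : Prop :=
  LocallyIntegrable g ∧ LocallyIntegrable g' ∧
    ∀ φ : ℝ → ℝ, ContDiff ℝ ∞ φ → HasCompactSupport φ →
      ∫ x, g x * deriv φ x = -∫ x, g' x * φ x

open Classical in
/-- The weak derivative of `g` (determined up to a null set); `0` if there is none. -/
def weakDeriv (g : ℝ → ℝ) : ℝ → ℝ :=
  if h : ∃ g', HasWeakDeriv g g' then h.choose else 0

/-- Membership in the Sobolev space `H¹(ℝ)`. -/
def MemH1 (g : ℝ → ℝ) : Prop :=
  MemLp g 2 ∧ ∃ g' : ℝ → ℝ, HasWeakDeriv g g' ∧ MemLp g' 2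

/-- A smooth reference transition `Q♯` between `ζ₁` (on `x < -1`) and `ζ₂` (on `x > 1`), with values
in the closed segment of end points `ζ₁`, `ζ₂`. -/
structure IsTransition (ζ₁ ζ₂ : ℝ) (Qs : ℝ → ℝ) : Prop where
  smooth : ContDiff ℝ ∞ Qs
  mem_segment : ∀ x, Qs x ∈ uIcc ζ₁ ζ₂
  eq_left : ∀ x, x < -1 → Qs x = ζ₁
  eq_right : ∀ x, 1 < x → Qs x = ζ₂

/-- A smooth obstacle that is equal to `c₁` near `-∞` and to `c₂` near `+∞`. -/
structure IsObstacle (c₁ c₂ : ℝ) (Θ : ℝ → ℝ) : Prop where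
  smooth : ContDiff ℝ ∞ Θ
  eq_left : ∀ᶠ x in atBot, Θ x = c₁
  eq_right : ∀ᶠ x in atTop, Θ x = c₂

/-- The class `Σ` of the functions `Q` with `Q - Q♯ ∈ H¹(ℝ)` and `Ψ ≤ Q ≤ Φ` in `ℝ`. -/
def admissible (Qs Ψ Φ : ℝ → ℝ) : Set (ℝ → ℝ) :=
  {Q | MemH1 (fun x => Q x - Qs x) ∧ ∀ x, Ψ x ≤ Q x ∧ Q x ≤ Φ x}

/-- The bilinear form
`η ∫ u' g' + (1/2) ∬ (u(x) - u(y)) (g(x) - g(y)) K(x - y)` evaluated at `g = u - v`. -/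
def energyForm (η : ℝ) (K u v : ℝ → ℝ) : ℝ :=
  η * (∫ x, weakDeriv u x * (weakDeriv u x - weakDeriv v x)) +
    1 / 2 * ∫ p : ℝ × ℝ,
      (u p.1 - u p.2) * ((u p.1 - v p.1) - (u p.2 - v p.2)) * K (p.1 - p.2)

/-- `u` satisfies, on `I`, the variational inequality with right-hand side `f` in the class `Σ`. -/
def SolvesVariationalInequality
    (η : ℝ) (K Qs Ψ Φ : ℝ → ℝ) (I : Set ℝ) (f u : ℝ → ℝ) : Prop :=
  ∀ v ∈ admissible Qs Ψ Φ, (∀ x ∉ I, v x = u x) →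
    energyForm η K u v ≤ ∫ x, f x * (u x - v x)

/-- Test functions of class `C_c^∞` on the interior of `I`. -/
structure IsTestFunction (I : Set ℝ) (φ : ℝ → ℝ) : Prop where
  smooth : ContDiff ℝ ∞ φ
  compact_support : HasCompactSupport φ
  support_subset : tsupport φ ⊆ interior I

/-- The action of the distribution `-η u'' + 𝓛 u` on a test function `φ`: all the operators are moved
onto `φ` (the operator `𝓛` is symmetric because `K` is even). -/
def distribPairing (η : ℝ) (K u φ : ℝ → ℝ) : ℝ :=
  -η * (∫ x, u x * iteratedDeriv 2 φ x) + ∫ x, u x * nonlocalOp K φ x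

/-- `m ≤ -η u'' + 𝓛 u ≤ M` in `I` in the sense of distributions: the pairing with every test function
is well defined, and it is squeezed when the test function is nonnegative. -/
def DistribBetween (η : ℝ) (K u : ℝ → ℝ) (I : Set ℝ) (m M : ℝ) : Prop :=
  ∀ φ : ℝ → ℝ, IsTestFunction I φ →
    ((∀ x, HasPrincipalValue K φ x) ∧ Integrable (fun x => u x * nonlocalOp K φ x)) ∧
    ((∀ x, 0 ≤ φ x) →
      m * (∫ x, φ x) ≤ distribPairing η K u φ ∧ distribPairing η K u φ ≤ M * ∫ x, φ x)

end MixedObstacle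

end

namespace MixedObstacle

/-! This is a Lewy–Stampacchia estimate, obtained by truncation rather than penalization. For the
upper bound write `E` for the bilinear form of the mixed operator, fix a test function `φ ≥ 0` and
`ε > 0`, and compare `u` with `v = max (u - ε φ) Ψ`, that is, `u - v = min (ε φ) (u - Ψ) = ε φ - p`
with `p = (ε φ - (u - Ψ))⁺`. The inequality gives `E(u, ε φ - p) ≤ M ∫ (ε φ - p)`. With `q = ε φ - u
+ Ψ` one has `p = q⁺`, and `E(q, q⁺) ≥ 0` because truncation is monotone. Hence `E(u, p) ≤ ε E(φ, p)
+ E(Ψ, p)`. The last term is at most `M ∫ p`, since the operator applied to `Ψ` is at most `M` on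
`I`; the other is `O(ε²)`, since `0 ≤ p ≤ ε φ`. Adding, dividing by `ε` and letting `ε → 0` gives
`E(u, φ) ≤ M ∫ φ`: this is `mixedForm_le_of_obstacle`. The lower bound is the upper bound for `-u`,
with the obstacles exchanged and reflected.

The remaining work makes `E` meaningful and computable. The kernel enters only through evenness,
sign and integrability of `min(1, z²) K(z)`, so principal values become integrals of second
differences (`symmOp`). Since `u` need not be integrable, the integrals converge because it is
bounded with derivative in `L²` while the other argument is integrable
(`IsBoundedDirichlet.integrable_diff_mul_diff`). Summation by parts
(`nonlocalForm_eq_integral_mul_symmOp`) links `E` with the operators. Admissible functions are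
replaced by absolutely continuous representatives. -/

/-! ### Lévy kernels. -/

/-- A measurable even kernel, nonnegative off the origin, with `∫ min(1, z²) K(z) dz < ∞`. -/
structure IsLevyKernel (K : ℝ → ℝ) : Prop where
  measurable : Measurable K
  even : ∀ z, K (-z) = K z
  nonneg : ∀ z, z ≠ 0 → 0 ≤ K z
  integrable : Integrable (fun z => min 1 (z ^ 2) * K z)

theorem IsLevyKernel.ae_nonneg {K : ℝ → ℝ} (hK : IsLevyKernel K) : ∀ᵐ z, 0 ≤ K z := by
  filter_upwards [Measure.ae_ne volume (0 : ℝ)] with z hz using hK.nonneg z hz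

theorem IsKernel.nonneg {s θ₀ Θ₀ r₀ : ℝ} {K : ℝ → ℝ} (hK : IsKernel s θ₀ Θ₀ r₀ K)
    (z : ℝ) (hz : z ≠ 0) : 0 ≤ K z := by
  refine le_trans ?_ (hK.lower z hz)
  refine indicator_nonneg (fun t _ => ?_) z
  have := hK.theta_pos
  positivity

/-- Near the origin `z² |z|^(-1-2s)` is bounded because `s ≤ 1/2`; at infinity `|z|^(-1-2s)` is
integrable because `s > 0`. -/
theorem IsKernel.isLevyKernel {s θ₀ Θ₀ r₀ : ℝ} {K : ℝ → ℝ} (hs : 0 < s) (hs' : s ≤ 1 / 2)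
    (hK : IsKernel s θ₀ Θ₀ r₀ K) : IsLevyKernel K where
  measurable := hK.measurable
  even := hK.even
  nonneg := hK.nonneg
  integrable := by
    have hΘ : 0 < Θ₀ := hK.theta_pos.trans_le hK.theta_le
    -- The factor `2 ^ (1 + 2 * s)` absorbs `1 + |z| ≤ 2 max(1, |z|)`, so one majorant serves both
    -- regimes.
    have hint : Integrable (fun z : ℝ => Θ₀ * 2 ^ (1 + 2 * s) * (1 + ‖z‖) ^ (-(1 + 2 * s))) :=
      (integrable_one_add_norm (E := ℝ) (μ := volume) (r := 1 + 2 * s)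
        (by simp; linarith)).const_mul _
    refine hint.mono' ?_ ?_
    · have := hK.measurable
      exact (by fun_prop : Measurable fun z => min 1 (z ^ 2) * K z).aestronglyMeasurable
    · filter_upwards [Measure.ae_ne volume (0 : ℝ)] with z hz
      have hK0 := hK.nonneg z hz
      have hz' : 0 < |z| := abs_pos.2 hz
      rw [Real.norm_of_nonneg (by positivity), Real.norm_eq_abs, Real.rpow_neg (by positivity),
        mul_assoc, ← div_eq_mul_inv, ← Real.div_rpow (by norm_num) (by positivity)]
      have hu := hK.upper z hz
      rcases le_total |z| 1 with h1 | h1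
      · have e1 : min 1 (z ^ 2) * K z ≤ Θ₀ := by
          calc min 1 (z ^ 2) * K z ≤ |z| ^ (1 + 2 * s) * (Θ₀ / |z| ^ (1 + 2 * s)) := by
                gcongr
                refine (min_le_right _ _).trans ?_
                rw [← sq_abs, ← Real.rpow_two]
                exact Real.rpow_le_rpow_of_exponent_ge hz' h1 (by linarith)
            _ = Θ₀ := by field_simp
        refine e1.trans (le_mul_of_one_le_right hΘ.le (Real.one_le_rpow ?_ (by linarith)))
        rw [le_div_iff₀ (by positivity)]
        linarith
      · calc min 1 (z ^ 2) * K z ≤ 1 * (Θ₀ / |z| ^ (1 + 2 * s)) := by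
              gcongr
              exact min_le_left _ _
          _ = Θ₀ * (1 / |z|) ^ (1 + 2 * s) := by
              rw [Real.div_rpow (by norm_num) hz'.le, Real.one_rpow]; ring
          _ ≤ _ := by
              gcongr ?_ * ?_ ^ _
              rw [div_le_div_iff₀ hz' (by positivity)]
              linarith

/-! ### Bounded `C²` functions and the principal value. -/

/-- A `C²` function which is bounded, together with its second derivative, by `B`. -/
structure IsBoundedC2 (B : ℝ) (b : ℝ → ℝ) : Prop where
  contDiff : ContDiff ℝ 2 b
  bound : ∀ x, |b x| ≤ B
  bound_two : ∀ x, |deriv (deriv b) x| ≤ B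

theorem IsBoundedC2.bound_nonneg {B : ℝ} {b : ℝ → ℝ} (hb : IsBoundedC2 B b) : 0 ≤ B :=
  (abs_nonneg _).trans (hb.bound 0)

/-- For small `z`, the second difference is an increment over `[0, z]` of `t ↦ b (x + t) + b (x -
t)`, whose derivative is at most `2 B |z|` there because `b'` is `B`-Lipschitz. For large `z` the
sup bound suffices. -/
theorem IsBoundedC2.abs_second_diff_le {B : ℝ} {b : ℝ → ℝ} (hb : IsBoundedC2 B b) (x z : ℝ) :
    |2 * b x - b (x + z) - b (x - z)| ≤ 4 * B * min 1 (z ^ 2) := by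
  have hB := hb.bound_nonneg
  have hd : Differentiable ℝ b := hb.contDiff.differentiable (by norm_num)
  have hd' : Differentiable ℝ (deriv b) :=
    ((contDiff_succ_iff_deriv (n := 1)).1 hb.contDiff).2.2.differentiable (by norm_num)
  have hfar : |2 * b x - b (x + z) - b (x - z)| ≤ 4 * B := by
    have h1 := abs_le.1 (hb.bound x)
    have h2 := abs_le.1 (hb.bound (x + z))
    have h3 := abs_le.1 (hb.bound (x - z))
    rw [abs_le]; constructor <;> linarith
  have hnear : |2 * b x - b (x + z) - b (x - z)| ≤ 4 * B * z ^ 2 := by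
    have hb' : ∀ s t, |deriv b s - deriv b t| ≤ B * |s - t| := fun s t => by
      simpa using Convex.norm_image_sub_le_of_norm_deriv_le (s := univ) (f := deriv b) (C := B)
        (fun y _ => hd' y) (fun y _ => hb.bound_two y) convex_univ (mem_univ t) (mem_univ s)
    have hder : ∀ t, HasDerivAt (fun t => b (x + t) + b (x - t))
        (deriv b (x + t) - deriv b (x - t)) t := fun t => by
      have h1 : HasDerivAt (fun t => b (x + t)) (deriv b (x + t)) t :=
        (hd (x + t)).hasDerivAt.comp_const_add x t
      have h2 : HasDerivAt (fun t => b (x - t)) (-deriv b (x - t)) t :=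
        (hd (x - t)).hasDerivAt.comp_const_sub x t
      exact (h1.add h2).congr_deriv (by ring)
    have key := Convex.norm_image_sub_le_of_norm_hasDerivWithin_le (s := uIcc 0 z)
      (f := fun t => b (x + t) + b (x - t)) (C := 2 * B * |z|)
      (fun t _ => (hder t).hasDerivWithinAt)
      (fun t ht => by
        have h1 := hb' (x + t) (x - t)
        have h2 : |t| ≤ |z| := by simpa using abs_sub_left_of_mem_uIcc ht
        have h3 : |x + t - (x - t)| = 2 * |t| := by
          rw [show x + t - (x - t) = 2 * t by ring, abs_mul, abs_two]
        rw [Real.norm_eq_abs]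
        rw [h3] at h1
        nlinarith)
      (convex_uIcc 0 z) left_mem_uIcc right_mem_uIcc
    simp only [Real.norm_eq_abs, add_zero, sub_zero] at key
    rw [abs_sub_comm] at key
    calc _ = |b x + b x - (b (x + z) + b (x - z))| := by congr 1; ring
      _ ≤ _ := key
      _ = 2 * B * z ^ 2 := by rw [mul_assoc, abs_mul_abs_self]; ring
      _ ≤ _ := by nlinarith [mul_nonneg hB (sq_nonneg z)]
  rcases min_choice 1 (z ^ 2) with h | h <;> rw [h]
  · simpa using hfar
  · exact hnear

/-- The absolutely convergent form of the operator, on second differences. -/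
noncomputable def symmOp (K b : ℝ → ℝ) (x : ℝ) : ℝ :=
  1 / 2 * ∫ z, (2 * b x - b (x + z) - b (x - z)) * K z

theorem IsBoundedC2.integrable_second_diff {B : ℝ} {b K : ℝ → ℝ} (hb : IsBoundedC2 B b)
    (hK : IsLevyKernel K) (x : ℝ) :
    Integrable (fun z => (2 * b x - b (x + z) - b (x - z)) * K z) := by
  refine (hK.integrable.const_mul (4 * B)).mono' ?_ ?_
  · have h1 := hb.contDiff.continuous
    exact ((by fun_prop : Continuous fun z => 2 * b x - b (x + z) - b (x - z)).measurable.mul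
      hK.measurable).aestronglyMeasurable
  · filter_upwards [hK.ae_nonneg] with z hz
    rw [norm_mul, Real.norm_eq_abs, Real.norm_of_nonneg hz, ← mul_assoc]
    gcongr
    exact hb.abs_second_diff_le x z

theorem IsBoundedC2.abs_symmOp_le {B : ℝ} {b K : ℝ → ℝ} (hb : IsBoundedC2 B b)
    (hK : IsLevyKernel K) (x : ℝ) :
    |symmOp K b x| ≤ 2 * B * ∫ z, min 1 (z ^ 2) * K z := by
  have : ‖∫ z, (2 * b x - b (x + z) - b (x - z)) * K z‖ ≤
      ∫ z, 4 * B * (min 1 (z ^ 2) * K z) := by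
    refine norm_integral_le_of_norm_le (hK.integrable.const_mul (4 * B)) ?_
    filter_upwards [hK.ae_nonneg] with z hz
    rw [norm_mul, Real.norm_eq_abs, Real.norm_of_nonneg hz, ← mul_assoc]
    gcongr
    exact hb.abs_second_diff_le x z
  rw [integral_const_mul, Real.norm_eq_abs] at this
  rw [symmOp, abs_mul, abs_of_pos (by norm_num : (0 : ℝ) < 1 / 2)]
  linarith

theorem IsLevyKernel.integrableOn_compl_ball {K : ℝ → ℝ} (hK : IsLevyKernel K) {ϱ : ℝ}
    (hϱ : 0 < ϱ) : IntegrableOn K (Metric.ball 0 ϱ)ᶜ := by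
  have hm : 0 < min 1 (ϱ ^ 2) := by positivity
  refine ((hK.integrable.const_mul (min 1 (ϱ ^ 2))⁻¹).integrableOn).mono'
    hK.measurable.aestronglyMeasurable ?_
  filter_upwards [ae_restrict_mem Metric.isOpen_ball.measurableSet.compl,
    ae_restrict_of_ae hK.ae_nonneg] with z hz hz0
  rw [Real.norm_of_nonneg hz0, ← mul_assoc]
  refine le_mul_of_one_le_left hz0 ?_
  rw [inv_mul_eq_div, one_le_div hm]
  have : ϱ ≤ |z| := by simpa using hz
  rw [← sq_abs z]
  gcongr

/-- Off a ball the kernel is integrable, so the truncated integral may be averaged with its image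
under `z ↦ -z`; evenness of `K` turns the average into second differences. These are integrable up
to the origin, so dominated convergence then gives the principal value. -/
theorem IsBoundedC2.truncatedOp_eq {B : ℝ} {b K : ℝ → ℝ} (hb : IsBoundedC2 B b)
    (hK : IsLevyKernel K) (x : ℝ) {ϱ : ℝ} (hϱ : 0 < ϱ) :
    truncatedOp K b x ϱ = 1 / 2 * ∫ z, (Metric.ball (0 : ℝ) ϱ)ᶜ.indicator
      (fun z => (2 * b x - b (x + z) - b (x - z)) * K z) z := by
  have hS : MeasurableSet (Metric.ball (0 : ℝ) ϱ)ᶜ := Metric.isOpen_ball.measurableSet.compl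
  have hSx : MeasurableSet (Metric.ball x ϱ)ᶜ := Metric.isOpen_ball.measurableSet.compl
  have hc := hb.contDiff.continuous
  have h1 : truncatedOp K b x ϱ = ∫ z in (Metric.ball (0 : ℝ) ϱ)ᶜ, (b x - b (x + z)) * K z := by
    rw [truncatedOp, ← integral_indicator hSx, ← integral_indicator hS,
      ← integral_add_left_eq_self _ x]
    congr 1 with z
    simp only [indicator, mem_compl_iff, Metric.mem_ball, Real.dist_eq, sub_zero,
      add_sub_cancel_left]
    rw [show x - (x + z) = -z by ring, hK.even]
  have h2 : truncatedOp K b x ϱ = ∫ z in (Metric.ball (0 : ℝ) ϱ)ᶜ, (b x - b (x - z)) * K z := by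
    rw [h1, ← integral_indicator hS, ← integral_indicator hS, ← integral_neg_eq_self]
    congr 1 with z
    simp only [indicator, mem_compl_iff, Metric.mem_ball, Real.dist_eq, sub_zero, abs_neg, hK.even]
    rfl
  have hi : ∀ c : ℝ → ℝ, Continuous c → (∀ z, |c z| ≤ B) →
      IntegrableOn (fun z => (b x - c z) * K z) (Metric.ball (0 : ℝ) ϱ)ᶜ := fun c hc hcB => by
    refine (hK.integrableOn_compl_ball hϱ).bdd_mul (c := 2 * B)
      (by fun_prop : Continuous fun z => b x - c z).aestronglyMeasurable ?_
    refine ae_of_all _ fun z => ?_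
    have h1 := abs_le.1 (hb.bound x)
    have h2 := abs_le.1 (hcB z)
    rw [Real.norm_eq_abs, abs_le]; constructor <;> linarith
  have hsum : truncatedOp K b x ϱ + truncatedOp K b x ϱ =
      ∫ z in (Metric.ball (0 : ℝ) ϱ)ᶜ, (2 * b x - b (x + z) - b (x - z)) * K z := by
    nth_rewrite 1 [h1]
    rw [h2, ← integral_add (hi _ (by fun_prop) fun z => hb.bound _)
      (hi _ (by fun_prop) fun z => hb.bound _)]
    congr 1 with z
    ring
  rw [integral_indicator hS, ← hsum]
  ring

theorem IsBoundedC2.tendsto_truncatedOp {B : ℝ} {b K : ℝ → ℝ} (hb : IsBoundedC2 B b)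
    (hK : IsLevyKernel K) (x : ℝ) :
    Tendsto (truncatedOp K b x) (𝓝[>] 0) (𝓝 (symmOp K b x)) := by
  have hev : ∀ᶠ ϱ in 𝓝[>] (0 : ℝ), 1 / 2 * ∫ z, (Metric.ball (0 : ℝ) ϱ)ᶜ.indicator
      (fun z => (2 * b x - b (x + z) - b (x - z)) * K z) z = truncatedOp K b x ϱ := by
    filter_upwards [self_mem_nhdsWithin] with ϱ hϱ using (hb.truncatedOp_eq hK x hϱ).symm
  refine Tendsto.congr' hev (Tendsto.const_mul _ ?_)
  have hint := hb.integrable_second_diff hK x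
  refine tendsto_integral_filter_of_dominated_convergence
    (fun z => ‖(2 * b x - b (x + z) - b (x - z)) * K z‖) ?_ ?_ hint.norm ?_
  · exact Eventually.of_forall fun ϱ =>
      hint.aestronglyMeasurable.indicator Metric.isOpen_ball.measurableSet.compl
  · exact Eventually.of_forall fun ϱ => ae_of_all _ fun z => norm_indicator_le_norm_self _ _
  · filter_upwards [Measure.ae_ne volume (0 : ℝ)] with z hz
    refine tendsto_const_nhds.congr' ?_
    have : ∀ᶠ ϱ in 𝓝[>] (0 : ℝ), ϱ < |z| :=
      (eventually_lt_nhds (abs_pos.2 hz)).filter_mono nhdsWithin_le_nhds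
    filter_upwards [this] with ϱ hϱ
    rw [indicator_of_mem]
    simpa using hϱ.le

theorem IsBoundedC2.hasPrincipalValue {B : ℝ} {b K : ℝ → ℝ} (hb : IsBoundedC2 B b)
    (hK : IsLevyKernel K) (x : ℝ) : HasPrincipalValue K b x :=
  ⟨_, hb.tendsto_truncatedOp hK x⟩

theorem IsBoundedC2.nonlocalOp_eq {B : ℝ} {b K : ℝ → ℝ} (hb : IsBoundedC2 B b)
    (hK : IsLevyKernel K) (x : ℝ) : nonlocalOp K b x = symmOp K b x :=
  (hb.tendsto_truncatedOp hK x).limUnder_eq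

theorem symmOp_neg (K b : ℝ → ℝ) (x : ℝ) : symmOp K (fun y => -b y) x = -symmOp K b x := by
  rw [symmOp, symmOp, ← mul_neg, ← integral_neg]
  congr 2 with z
  ring

/-! ### Bounded functions of finite Dirichlet energy and convergence of the nonlocal form. -/

theorem integrable_comp_add_mul {h k : ℝ → ℝ} (hh : Integrable h) (hk : Integrable k) :
    Integrable (fun p : ℝ × ℝ => h (p.1 + p.2) * k p.2) :=
  (measurePreserving_add_prod volume volume).integrable_comp_of_integrable (hh.mul_prod hk)

theorem integrable_comp_sub_mul {h k : ℝ → ℝ} (hh : Integrable h) (hk : Integrable k) :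
    Integrable (fun p : ℝ × ℝ => h (p.1 - p.2) * k p.2) :=
  (measurePreserving_sub_prod volume volume).integrable_comp_of_integrable (hh.mul_prod hk)

theorem IsLevyKernel.ae_nonneg_snd {K : ℝ → ℝ} (hK : IsLevyKernel K) :
    ∀ᵐ p : ℝ × ℝ, 0 ≤ K p.2 :=
  Measure.quasiMeasurePreserving_snd.ae hK.ae_nonneg

/-- A bounded, locally absolutely continuous function with square integrable derivative. -/
structure IsBoundedDirichlet (a : ℝ → ℝ) : Prop where
  ac : ∀ x y, AbsolutelyContinuousOnInterval a x y
  memLp : MemLp (deriv a) 2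
  bounded : ∃ A, ∀ x, |a x| ≤ A

theorem continuous_of_absolutelyContinuousOnInterval {a : ℝ → ℝ}
    (ha : ∀ x y, AbsolutelyContinuousOnInterval a x y) : Continuous a := by
  rw [continuous_iff_continuousAt]
  intro x
  refine (ha (x - 1) (x + 1)).continuousOn.continuousAt ?_
  rw [uIcc_of_le (by linarith)]
  exact Icc_mem_nhds (by linarith) (by linarith)

theorem ae_differentiableAt_of_absolutelyContinuousOnInterval {a : ℝ → ℝ}
    (ha : ∀ x y, AbsolutelyContinuousOnInterval a x y) : ∀ᵐ x, DifferentiableAt ℝ a x := by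
  have h : ∀ᵐ x, ∀ n : ℕ, x ∈ uIcc (-(n : ℝ)) n → DifferentiableAt ℝ a x :=
    ae_all_iff.2 fun n => (ha (-n) n).ae_differentiableAt
  filter_upwards [h] with x hx
  obtain ⟨n, hn⟩ := exists_nat_ge |x|
  refine hx n ?_
  rw [uIcc_of_le (by linarith [n.cast_nonneg (α := ℝ)])]
  exact abs_le.1 hn

theorem IsBoundedDirichlet.continuous {a : ℝ → ℝ} (ha : IsBoundedDirichlet a) : Continuous a :=
  continuous_of_absolutelyContinuousOnInterval ha.ac

theorem IsBoundedDirichlet.ae_differentiableAt {a : ℝ → ℝ} (ha : IsBoundedDirichlet a) :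
    ∀ᵐ x, DifferentiableAt ℝ a x :=
  ae_differentiableAt_of_absolutelyContinuousOnInterval ha.ac

/-- Cauchy–Schwarz for the integral of the derivative over the segment from `x` to `x + z`. -/
theorem IsBoundedDirichlet.sq_diff_le {a : ℝ → ℝ} (ha : IsBoundedDirichlet a) (x z : ℝ) :
    (a x - a (x + z)) ^ 2 ≤ |z| * ∫ t in uIoc 0 z, deriv a (x + t) ^ 2 := by
  have hsq : IntegrableOn (fun t => deriv a (x + t) ^ 2) (uIoc 0 z) :=
    (ha.memLp.integrable_sq.comp_add_left x).integrableOn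
  have h1 : IntegrableOn (fun t => deriv a (x + t)) (uIoc 0 z) := by
    have hm : MemLp (fun t => deriv a (x + t)) 2 :=
      ha.memLp.comp_measurePreserving (measurePreserving_add_left volume x)
    exact ((hm.locallyIntegrable (by norm_num)).integrableOn_isCompact
      (isCompact_uIcc (a := (0 : ℝ)) (b := z))).mono_set uIoc_subset_uIcc
  set J := ∫ t in uIoc 0 z, |deriv a (x + t)| with hJ
  have hJ0 : 0 ≤ J := integral_nonneg fun _ => abs_nonneg _
  have hle : |a x - a (x + z)| ≤ J := by
    have e : ∫ t in (0 : ℝ)..z, deriv a (x + t) = a (x + z) - a x := by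
      rw [intervalIntegral.integral_comp_add_left (fun t => deriv a t), add_zero]
      exact (ha.ac _ _).integral_deriv_eq_sub
    rw [abs_sub_comm, ← e]
    exact intervalIntegral.norm_integral_le_integral_norm_uIoc (f := fun t => deriv a (x + t))
  have hquad : ∀ c : ℝ, 2 * c * J ≤ (∫ t in uIoc 0 z, deriv a (x + t) ^ 2) + c ^ 2 * |z| := by
    intro c
    have hc : IntegrableOn (fun _ : ℝ => c ^ 2) (uIoc 0 z) :=
      integrableOn_const (by simp [uIoc])
    have : ∫ t in uIoc 0 z, 2 * c * |deriv a (x + t)| ≤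
        ∫ t in uIoc 0 z, (deriv a (x + t) ^ 2 + c ^ 2) := by
      refine integral_mono (h1.abs.const_mul _) (hsq.add hc) fun t => ?_
      have := sq_nonneg (|deriv a (x + t)| - c)
      simp only
      rw [← sq_abs (deriv a (x + t))]
      linarith
    rw [integral_const_mul, integral_add hsq hc, setIntegral_const, smul_eq_mul] at this
    have hv : volume.real (uIoc 0 z) = |z| := by
      simp [uIoc, measureReal_def, max_sub_min_eq_abs]
    rw [hv] at this
    linarith
  have hJz : J ^ 2 ≤ |z| * ∫ t in uIoc 0 z, deriv a (x + t) ^ 2 := by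
    rcases eq_or_ne z 0 with rfl | hz
    · simp [hJ]
    · have hz' : 0 < |z| := abs_pos.2 hz
      -- The optimal `c` in the family of quadratic inequalities, which recovers Cauchy–Schwarz.
      have := hquad (J / |z|)
      have e : 2 * (J / |z|) * J - (J / |z|) ^ 2 * |z| = J ^ 2 / |z| := by field_simp; ring
      rw [← div_le_iff₀' hz']
      linarith
  refine le_trans ?_ hJz
  rw [← sq_abs]
  gcongr

theorem IsBoundedDirichlet.integrable_setIntegral {a : ℝ → ℝ} (ha : IsBoundedDirichlet a)
    (z : ℝ) : Integrable (fun x => ∫ t in uIoc 0 z, deriv a (x + t) ^ 2) ∧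
      ∫ x, ∫ t in uIoc 0 z, deriv a (x + t) ^ 2 = |z| * ∫ x, deriv a x ^ 2 := by
  have hk : Integrable ((uIoc 0 z).indicator fun _ => (1 : ℝ)) :=
    (integrable_indicator_iff measurableSet_uIoc).2
      (integrableOn_const (by simp [uIoc]))
  have hprod := integrable_comp_add_mul ha.memLp.integrable_sq hk
  have e : ∀ x, ∫ t in uIoc 0 z, deriv a (x + t) ^ 2 =
      ∫ t, deriv a (x + t) ^ 2 * (uIoc 0 z).indicator (fun _ => (1 : ℝ)) t := fun x => by
    rw [← integral_indicator measurableSet_uIoc]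
    congr 1 with t
    by_cases ht : t ∈ uIoc 0 z <;> simp [ht]
  simp only [e]
  refine ⟨hprod.integral_prod_left, ?_⟩
  rw [integral_integral_swap (f := fun x t =>
    deriv a (x + t) ^ 2 * (uIoc 0 z).indicator (fun _ => (1 : ℝ)) t) hprod]
  simp only [integral_mul_const]
  have e2 : ∀ t, ∫ x, deriv a (x + t) ^ 2 = ∫ x, deriv a x ^ 2 := fun t =>
    integral_add_right_eq_self (fun x => deriv a x ^ 2) t
  simp only [e2, integral_const_mul, integral_indicator measurableSet_uIoc, setIntegral_const]
  simp [uIoc, measureReal_def, mul_comm, max_sub_min_eq_abs]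

theorem IsBoundedDirichlet.integrable_sq_diff {a : ℝ → ℝ} (ha : IsBoundedDirichlet a) (z : ℝ) :
    Integrable (fun x => (a x - a (x + z)) ^ 2) ∧
      ∫ x, (a x - a (x + z)) ^ 2 ≤ z ^ 2 * ∫ x, deriv a x ^ 2 := by
  obtain ⟨hi, he⟩ := ha.integrable_setIntegral z
  have hc := ha.continuous
  have hint : Integrable (fun x => (a x - a (x + z)) ^ 2) := by
    refine (hi.const_mul |z|).mono' (by fun_prop : Continuous _).aestronglyMeasurable ?_
    filter_upwards with x
    rw [Real.norm_of_nonneg (sq_nonneg _)]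
    exact ha.sq_diff_le x z
  refine ⟨hint, (integral_mono hint (hi.const_mul |z|) fun x => ha.sq_diff_le x z).trans_eq ?_⟩
  rw [integral_const_mul, he, ← mul_assoc, abs_mul_abs_self, sq]

/-- Integrating in `x` first produces the factor `z² ∫ (a')²`, exactly what the kernel tolerates for
`|z| ≤ 1`. -/
theorem IsBoundedDirichlet.integrable_near {a K : ℝ → ℝ} (ha : IsBoundedDirichlet a)
    (hK : IsLevyKernel K) :
    Integrable (fun p : ℝ × ℝ =>
      (a p.1 - a (p.1 + p.2)) ^ 2 * (Icc (-1 : ℝ) 1).indicator K p.2) := by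
  have hc := ha.continuous
  have hKm : Measurable ((Icc (-1 : ℝ) 1).indicator K) := hK.measurable.indicator measurableSet_Icc
  have hmeas : AEStronglyMeasurable (fun p : ℝ × ℝ =>
      (a p.1 - a (p.1 + p.2)) ^ 2 * (Icc (-1 : ℝ) 1).indicator K p.2) (volume.prod volume) :=
    ((by fun_prop : Continuous fun p : ℝ × ℝ => (a p.1 - a (p.1 + p.2)) ^ 2).measurable.mul
      (hKm.comp measurable_snd)).aestronglyMeasurable
  refine (integrable_prod_iff' hmeas).2 ⟨ae_of_all _ fun z =>
    (ha.integrable_sq_diff z).1.mul_const ((Icc (-1 : ℝ) 1).indicator K z), ?_⟩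
  refine (hK.integrable.mul_const (∫ x, deriv a x ^ 2)).mono'
    hmeas.norm.prod_swap.integral_prod_right' ?_
  filter_upwards [hK.ae_nonneg] with z hz
  rw [Real.norm_of_nonneg (integral_nonneg fun _ => norm_nonneg _)]
  by_cases h : z ∈ Icc (-1 : ℝ) 1
  · have hz1 : z ^ 2 ≤ 1 := by nlinarith [h.1, h.2]
    simp only [indicator_of_mem h, norm_mul, norm_pow, Real.norm_eq_abs, sq_abs, abs_of_nonneg hz]
    rw [integral_mul_const, min_eq_right hz1, mul_right_comm]
    gcongr
    exact (ha.integrable_sq_diff z).2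
  · simp only [indicator_of_notMem h, mul_zero, norm_zero, integral_zero]
    have : 0 ≤ ∫ x, deriv a x ^ 2 := integral_nonneg fun _ => sq_nonneg _
    positivity

/-- For `|z| ≤ 1` the product is controlled by the two squares; for `|z| > 1` the difference of `a`
is merely bounded and integrability in `x` comes from `b`. Thus `a` may have different nonzero
limits at the two ends. -/
theorem IsBoundedDirichlet.integrable_diff_mul_diff {a b K : ℝ → ℝ} (ha : IsBoundedDirichlet a)
    (hb : IsBoundedDirichlet b) (hb1 : Integrable b) (hK : IsLevyKernel K) :
    Integrable (fun p : ℝ × ℝ =>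
      (a p.1 - a (p.1 + p.2)) * (b p.1 - b (p.1 + p.2)) * K p.2) := by
  obtain ⟨A, hA⟩ := ha.bounded
  have hA0 : 0 ≤ A := (abs_nonneg _).trans (hA 0)
  have hac := ha.continuous
  have hbc := hb.continuous
  have hdom := (((ha.integrable_near hK).add (hb.integrable_near hK)).const_mul (1 / 2)).add
    (((hb1.norm.mul_prod hK.integrable).add
      (integrable_comp_add_mul hb1.norm hK.integrable)).const_mul (2 * A))
  refine hdom.mono' ?_ ?_
  · exact ((by fun_prop : Continuous fun p : ℝ × ℝ =>
      (a p.1 - a (p.1 + p.2)) * (b p.1 - b (p.1 + p.2))).measurable.mul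
      (hK.measurable.comp measurable_snd)).aestronglyMeasurable
  · filter_upwards [hK.ae_nonneg_snd] with ⟨x, z⟩ hz
    simp only [Pi.add_apply, norm_mul, Real.norm_eq_abs, abs_of_nonneg hz] at hz ⊢
    by_cases h : z ∈ Icc (-1 : ℝ) 1
    · rw [indicator_of_mem h]
      have h1 : |a x - a (x + z)| * |b x - b (x + z)| ≤
          1 / 2 * ((a x - a (x + z)) ^ 2 + (b x - b (x + z)) ^ 2) := by
        have := sq_nonneg (|a x - a (x + z)| - |b x - b (x + z)|)
        rw [← sq_abs (a x - a (x + z)), ← sq_abs (b x - b (x + z))]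
        linarith
      have h2 := mul_le_mul_of_nonneg_right h1 hz
      have h3 : 0 ≤ 2 * A * (|b x| * (min 1 (z ^ 2) * K z) +
          |b (x + z)| * (min 1 (z ^ 2) * K z)) := by positivity
      linarith
    · rw [indicator_of_notMem h]
      have hz1 : 1 ≤ z ^ 2 := by
        by_contra hcon
        exact h (abs_le.1 ((sq_lt_one_iff_abs_lt_one z).1 (not_le.1 hcon)).le)
      have h1 : |a x - a (x + z)| ≤ 2 * A := by
        have := abs_sub (a x) (a (x + z))
        linarith [hA x, hA (x + z)]
      have h2 := abs_sub (b x) (b (x + z))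
      rw [min_eq_left hz1]
      have h3 : |a x - a (x + z)| * |b x - b (x + z)| ≤ 2 * A * (|b x| + |b (x + z)|) := by gcongr
      have h4 := mul_le_mul_of_nonneg_right h3 hz
      linarith

/-! ### The nonlocal form and summation by parts. -/

/-- The quadratic form of the kernel, in the variables `(x, z)` with `y = x + z`. -/
noncomputable def nonlocalForm (K a b : ℝ → ℝ) : ℝ :=
  1 / 2 * ∫ p : ℝ × ℝ, (a p.1 - a (p.1 + p.2)) * (b p.1 - b (p.1 + p.2)) * K p.2

/-- Summation by parts for the nonlocal form. -/
theorem nonlocalForm_eq_integral_mul_symmOp {a b K : ℝ → ℝ}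
    (h₁ : Integrable (fun p : ℝ × ℝ =>
      (a p.1 - a (p.1 + p.2)) * (b p.1 - b (p.1 + p.2)) * K p.2))
    (h₂ : Integrable (fun p : ℝ × ℝ =>
      a p.1 * ((2 * b p.1 - b (p.1 + p.2) - b (p.1 - p.2)) * K p.2)))
    (h₃ : ∀ z, Integrable (fun x => a x * (b x - b (x + z)))) :
    nonlocalForm K a b = ∫ x, a x * symmOp K b x := by
  -- At fixed `z`, translating the `a (x + z)` term by `z` moves both differences onto `b`. The two
  -- pieces are recombined into a second difference before Fubini is applied, since first
  -- differences alone need not be jointly integrable against `K`.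
  have e1 : ∀ z, ∫ x, (a x - a (x + z)) * (b x - b (x + z)) * K z =
      ∫ x, a x * ((2 * b x - b (x + z) - b (x - z)) * K z) := fun z => by
    have hm := h₃ (-z)
    have hs : ∫ x, a (x + z) * (b (x + z) - b x) = ∫ x, a x * (b x - b (x - z)) := by
      rw [← integral_add_right_eq_self (fun x => a x * (b x - b (x - z))) z]
      simp
    have hsi : Integrable (fun x => a (x + z) * (b (x + z) - b x)) := by
      simpa using hm.comp_add_right z
    have hm' : Integrable (fun x => a x * (b x - b (x - z))) := hm
    calc _ = ∫ x, (a x * (b x - b (x + z)) + a (x + z) * (b (x + z) - b x)) * K z := by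
          congr 1 with x; ring
      _ = ((∫ x, a x * (b x - b (x + z))) + ∫ x, a x * (b x - b (x - z))) * K z := by
          rw [integral_mul_const, integral_add (h₃ z) hsi, hs]
      _ = ∫ x, (a x * (b x - b (x + z)) + a x * (b x - b (x - z))) * K z := by
          rw [integral_mul_const, integral_add (h₃ z) hm']
      _ = _ := by congr 1 with x; ring
  rw [nonlocalForm, Measure.volume_eq_prod, integral_prod_symm _ h₁]
  simp only [e1]
  rw [← integral_integral_swap (f := fun x z => a x * ((2 * b x - b (x + z) - b (x - z)) * K z)) h₂,
    ← integral_const_mul]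
  congr 1 with x
  rw [integral_const_mul, symmOp]
  ring

theorem IsBoundedC2.integrable_mul_second_diff {a b K : ℝ → ℝ} {B : ℝ} (hb : IsBoundedC2 B b)
    (ha : Continuous a) (ha1 : Integrable a) (hK : IsLevyKernel K) :
    Integrable (fun p : ℝ × ℝ =>
      a p.1 * ((2 * b p.1 - b (p.1 + p.2) - b (p.1 - p.2)) * K p.2)) := by
  have hbc := hb.contDiff.continuous
  refine ((ha1.norm.mul_prod hK.integrable).const_mul (4 * B)).mono' ?_ ?_
  · exact ((ha.comp continuous_fst).measurable.mul ((by fun_prop : Continuous fun p : ℝ × ℝ =>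
      2 * b p.1 - b (p.1 + p.2) - b (p.1 - p.2)).measurable.mul
      (hK.measurable.comp measurable_snd))).aestronglyMeasurable
  · filter_upwards [hK.ae_nonneg_snd] with ⟨x, z⟩ hz
    simp only [norm_mul, Real.norm_eq_abs, abs_of_nonneg hz] at hz ⊢
    have h1 := mul_le_mul_of_nonneg_right (hb.abs_second_diff_le x z) hz
    have h2 := mul_le_mul_of_nonneg_left h1 (abs_nonneg (a x))
    linarith

/-- Here `a` is only bounded, so decay in `x` must come from `φ`. At distance more than one from the
support only jumps with `|z| > 1` see `φ`, and then the integrable terms `|φ (x ± z)|` dominate. -/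
theorem IsBoundedC2.integrable_bounded_mul_second_diff {a φ K : ℝ → ℝ} {A B : ℝ}
    (hφ : IsBoundedC2 B φ) (hφc : HasCompactSupport φ) (ha : Continuous a)
    (hA : ∀ x, |a x| ≤ A) (hK : IsLevyKernel K) :
    Integrable (fun p : ℝ × ℝ =>
      a p.1 * ((2 * φ p.1 - φ (p.1 + p.2) - φ (p.1 - p.2)) * K p.2)) := by
  have hc := hφ.contDiff.continuous
  have hA0 : 0 ≤ A := (abs_nonneg _).trans (hA 0)
  have hB := hφ.bound_nonneg
  have hφ1 : Integrable φ := hc.integrable_of_hasCompactSupport hφc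
  obtain ⟨R, hR⟩ : ∃ R, ∀ x, φ x ≠ 0 → |x| ≤ R := by
    obtain ⟨R, hR⟩ := hφc.isCompact.isBounded.exists_norm_le
    exact ⟨R, fun x hx => hR x (subset_tsupport _ hx)⟩
  set S := Icc (-(R + 1)) (R + 1)
  have hS : Integrable (S.indicator fun _ => 4 * B) :=
    (integrable_indicator_iff measurableSet_Icc).2 (integrableOn_const (by simp))
  have hdom := (((hS.mul_prod hK.integrable).add
    ((hφ1.norm.mul_prod hK.integrable).const_mul 2)).add
    ((integrable_comp_add_mul hφ1.norm hK.integrable).add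
      (integrable_comp_sub_mul hφ1.norm hK.integrable))).const_mul A
  refine hdom.mono' ?_ ?_
  · exact ((ha.comp continuous_fst).measurable.mul ((by fun_prop : Continuous fun p : ℝ × ℝ =>
      2 * φ p.1 - φ (p.1 + p.2) - φ (p.1 - p.2)).measurable.mul
      (hK.measurable.comp measurable_snd))).aestronglyMeasurable
  · filter_upwards [hK.ae_nonneg_snd] with ⟨x, z⟩ hz
    simp only [Pi.add_apply, norm_mul, Real.norm_eq_abs, abs_of_nonneg hz] at hz ⊢
    have hS0 : 0 ≤ S.indicator (fun _ => 4 * B) x :=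
      indicator_nonneg (fun _ _ => by positivity) x
    have key : |2 * φ x - φ (x + z) - φ (x - z)| ≤
        (S.indicator (fun _ => 4 * B) x + 2 * |φ x| + |φ (x + z)| + |φ (x - z)|) *
          min 1 (z ^ 2) := by
      rcases le_total (z ^ 2) 1 with h | h
      · by_cases hx : x ∈ S
        · rw [indicator_of_mem hx]
          refine (hφ.abs_second_diff_le x z).trans ?_
          gcongr
          linarith [abs_nonneg (φ x), abs_nonneg (φ (x + z)), abs_nonneg (φ (x - z))]
        · have hz1 := abs_le.1 ((sq_le_one_iff_abs_le_one z).1 h)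
          have hzero : ∀ y, |y - x| ≤ 1 → φ y = 0 := fun y hy => by
            by_contra hne
            have h1 := abs_le.1 (hR y hne)
            have h2 := abs_le.1 hy
            exact hx ⟨by linarith, by linarith⟩
          rw [hzero x (by simp), hzero (x + z) (by rw [abs_le]; constructor <;> linarith),
            hzero (x - z) (by rw [abs_le]; constructor <;> linarith)]
          simp only [mul_zero, sub_zero, abs_zero, add_zero]
          positivity
      · rw [min_eq_left h, mul_one]
        have h1 := abs_sub (2 * φ x - φ (x + z)) (φ (x - z))
        have h2 := abs_sub (2 * φ x) (φ (x + z))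
        rw [abs_mul, abs_two] at h2
        linarith
    calc |a x| * (|2 * φ x - φ (x + z) - φ (x - z)| * K z)
        ≤ A * ((S.indicator (fun _ => 4 * B) x + 2 * |φ x| + |φ (x + z)| + |φ (x - z)|) *
          min 1 (z ^ 2) * K z) := by
          gcongr
          exact hA x
      _ = _ := by ring

/-! ### Stability under linear operations and truncation; integration by parts. -/

theorem IsBoundedDirichlet.add {a b : ℝ → ℝ} (ha : IsBoundedDirichlet a)
    (hb : IsBoundedDirichlet b) : IsBoundedDirichlet (fun x => a x + b x) where
  ac x y := (ha.ac x y).fun_add (hb.ac x y)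
  memLp := by
    refine (memLp_congr_ae ?_).2 (ha.memLp.add hb.memLp)
    filter_upwards [ha.ae_differentiableAt, hb.ae_differentiableAt] with x h1 h2
      using deriv_fun_add h1 h2
  bounded := by
    obtain ⟨A, hA⟩ := ha.bounded
    obtain ⟨B, hB⟩ := hb.bounded
    exact ⟨A + B, fun x => (abs_add_le _ _).trans (add_le_add (hA x) (hB x))⟩

theorem IsBoundedDirichlet.const_mul {a : ℝ → ℝ} (ha : IsBoundedDirichlet a) (c : ℝ) :
    IsBoundedDirichlet (fun x => c * a x) where
  ac x y := (ha.ac x y).const_mul c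
  memLp := by
    refine (memLp_congr_ae ?_).2 (ha.memLp.const_mul c)
    filter_upwards [ha.ae_differentiableAt] with x h1 using deriv_const_mul c h1
  bounded := by
    obtain ⟨A, hA⟩ := ha.bounded
    refine ⟨|c| * A, fun x => ?_⟩
    rw [abs_mul]
    exact mul_le_mul_of_nonneg_left (hA x) (abs_nonneg c)

theorem IsBoundedDirichlet.neg {a : ℝ → ℝ} (ha : IsBoundedDirichlet a) :
    IsBoundedDirichlet (fun x => -a x) := by
  simpa using ha.const_mul (-1)

theorem IsBoundedDirichlet.sub {a b : ℝ → ℝ} (ha : IsBoundedDirichlet a)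
    (hb : IsBoundedDirichlet b) : IsBoundedDirichlet (fun x => a x - b x) := by
  simpa [sub_eq_add_neg] using ha.add hb.neg

theorem abs_max_zero_sub_le (s t : ℝ) : |max s 0 - max t 0| ≤ |s - t| := by
  simpa using abs_max_sub_max_le_abs s t 0

theorem mul_max_zero_sub_nonneg (s t : ℝ) : 0 ≤ (s - t) * (max s 0 - max t 0) := by
  rcases le_total s t with h | h
  · exact mul_nonneg_of_nonpos_of_nonpos (sub_nonpos.2 h)
      (sub_nonpos.2 (max_le_max_right 0 h))
  · exact mul_nonneg (sub_nonneg.2 h) (sub_nonneg.2 (max_le_max_right 0 h))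

/-- Truncation is 1-Lipschitz, so difference quotients compare; where the truncation is not
differentiable, its `deriv` is `0` by default and the bound is trivial. -/
theorem abs_deriv_max_zero_le {a : ℝ → ℝ} {x : ℝ} (ha : DifferentiableAt ℝ a x) :
    |deriv (fun y => max (a y) 0) x| ≤ |deriv a x| := by
  by_cases hp : DifferentiableAt ℝ (fun y => max (a y) 0) x
  · refine le_of_tendsto_of_tendsto'
      (hasDerivAt_iff_tendsto_slope.1 hp.hasDerivAt).abs
      (hasDerivAt_iff_tendsto_slope.1 ha.hasDerivAt).abs fun y => ?_
    rw [slope_def_field, slope_def_field, abs_div, abs_div]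
    exact div_le_div_of_nonneg_right (abs_max_zero_sub_le _ _) (abs_nonneg _)
  · rw [deriv_zero_of_not_differentiableAt hp, abs_zero]
    exact abs_nonneg _

theorem deriv_mul_deriv_max_zero_nonneg {a : ℝ → ℝ} {x : ℝ} (ha : DifferentiableAt ℝ a x) :
    0 ≤ deriv a x * deriv (fun y => max (a y) 0) x := by
  by_cases hp : DifferentiableAt ℝ (fun y => max (a y) 0) x
  · refine ge_of_tendsto' ((hasDerivAt_iff_tendsto_slope.1 ha.hasDerivAt).mul
      (hasDerivAt_iff_tendsto_slope.1 hp.hasDerivAt)) fun y => ?_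
    rw [slope_def_field, slope_def_field, div_mul_div_comm]
    exact div_nonneg (mul_max_zero_sub_nonneg _ _) (mul_self_nonneg _)
  · rw [deriv_zero_of_not_differentiableAt hp, mul_zero]

theorem IsBoundedDirichlet.max_zero {a : ℝ → ℝ} (ha : IsBoundedDirichlet a) :
    IsBoundedDirichlet (fun x => max (a x) 0) where
  ac x y := by
    refine squeeze_zero (fun t => Finset.sum_nonneg fun i _ => dist_nonneg) (fun t => ?_) (ha.ac x y)
    gcongr
    exact abs_max_zero_sub_le _ _
  memLp := by
    refine ha.memLp.mono (measurable_deriv _).aestronglyMeasurable ?_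
    filter_upwards [ha.ae_differentiableAt] with x hx using abs_deriv_max_zero_le hx
  bounded := by
    obtain ⟨A, hA⟩ := ha.bounded
    refine ⟨A, fun x => ?_⟩
    simpa using (abs_max_zero_sub_le (a x) 0).trans (by simpa using hA x)

theorem absolutelyContinuousOnInterval_of_contDiff {b : ℝ → ℝ} (hb : ContDiff ℝ 1 b) (x y : ℝ) :
    AbsolutelyContinuousOnInterval b x y :=
  hb.contDiffOn.absolutelyContinuousOnInterval

theorem IsBoundedC2.isBoundedDirichlet {B : ℝ} {b : ℝ → ℝ} (hb : IsBoundedC2 B b)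
    (hc : HasCompactSupport (deriv b)) : IsBoundedDirichlet b where
  ac := absolutelyContinuousOnInterval_of_contDiff (hb.contDiff.of_le (by norm_num))
  memLp := (hb.contDiff.continuous_deriv (by norm_num)).memLp_of_hasCompactSupport hc
  bounded := ⟨B, hb.bound⟩

theorem integral_mul_deriv_eq_neg_of_hasCompactSupport {a p : ℝ → ℝ}
    (ha : ∀ x y, AbsolutelyContinuousOnInterval a x y)
    (hp : ∀ x y, AbsolutelyContinuousOnInterval p x y) (hpc : HasCompactSupport p) :
    ∫ x, a x * deriv p x = -∫ x, deriv a x * p x := by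
  obtain ⟨R, hR⟩ := hpc.isCompact.isBounded.exists_norm_le
  have hsub : ∀ x, x ∈ tsupport p → x ∈ Ioc (-(R + 1)) (R + 1) := fun x hx => by
    have := abs_le.1 (hR x hx)
    exact ⟨by linarith, by linarith⟩
  have hzero : ∀ x, |x| = |R + 1| → p x = 0 := fun x hx => by
    by_contra hne
    have h1 : |x| ≤ R := hR x (subset_tsupport _ hne)
    rw [hx] at h1
    linarith [le_abs_self (R + 1)]
  have h1 : Function.support (fun x => a x * deriv p x) ⊆ Ioc (-(R + 1)) (R + 1) := fun x hx =>
    hsub x (support_deriv_subset (right_ne_zero_of_mul hx))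
  have h2 : Function.support (fun x => deriv a x * p x) ⊆ Ioc (-(R + 1)) (R + 1) := fun x hx =>
    hsub x (subset_tsupport _ (right_ne_zero_of_mul hx))
  rw [← intervalIntegral.integral_eq_integral_of_support_subset h1,
    ← intervalIntegral.integral_eq_integral_of_support_subset h2,
    (ha _ _).integral_mul_deriv_eq_deriv_mul (hp _ _), hzero (R + 1) rfl,
    hzero (-(R + 1)) (abs_neg _)]
  ring

/-! ### The mixed form. -/

/-- The bilinear form of the mixed operator, for functions with a pointwise derivative. -/
noncomputable def mixedForm (η : ℝ) (K a b : ℝ → ℝ) : ℝ :=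
  η * (∫ x, deriv a x * deriv b x) + nonlocalForm K a b

theorem IsBoundedDirichlet.integrable_deriv_mul_deriv {a b : ℝ → ℝ} (ha : IsBoundedDirichlet a)
    (hb : IsBoundedDirichlet b) : Integrable (fun x => deriv a x * deriv b x) :=
  ha.memLp.integrable_mul hb.memLp

theorem mixedForm_add {η : ℝ} {K a b c : ℝ → ℝ}
    (ha : IsBoundedDirichlet a) (hb : IsBoundedDirichlet b) (hc : IsBoundedDirichlet c)
    (hac : Integrable (fun p : ℝ × ℝ =>
      (a p.1 - a (p.1 + p.2)) * (c p.1 - c (p.1 + p.2)) * K p.2))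
    (hbc : Integrable (fun p : ℝ × ℝ =>
      (b p.1 - b (p.1 + p.2)) * (c p.1 - c (p.1 + p.2)) * K p.2)) :
    mixedForm η K (fun x => a x + b x) c = mixedForm η K a c + mixedForm η K b c := by
  have e1 : ∫ x, deriv (fun x => a x + b x) x * deriv c x =
      (∫ x, deriv a x * deriv c x) + ∫ x, deriv b x * deriv c x := by
    rw [← integral_add (ha.integrable_deriv_mul_deriv hc) (hb.integrable_deriv_mul_deriv hc)]
    refine integral_congr_ae ?_
    filter_upwards [ha.ae_differentiableAt, hb.ae_differentiableAt] with x h1 h2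
    rw [deriv_fun_add h1 h2, add_mul]
  have e2 : nonlocalForm K (fun x => a x + b x) c = nonlocalForm K a c + nonlocalForm K b c := by
    rw [nonlocalForm, nonlocalForm, nonlocalForm, ← mul_add,
      ← integral_add hac hbc]
    congr 2 with p
    ring
  rw [mixedForm, mixedForm, mixedForm, e1, e2]
  ring

theorem mixedForm_const_mul_left {η : ℝ} {K a b : ℝ → ℝ} (c : ℝ) (ha : IsBoundedDirichlet a) :
    mixedForm η K (fun x => c * a x) b = c * mixedForm η K a b := by
  have e1 : ∫ x, deriv (fun x => c * a x) x * deriv b x = c * ∫ x, deriv a x * deriv b x := by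
    rw [← integral_const_mul]
    refine integral_congr_ae ?_
    filter_upwards [ha.ae_differentiableAt] with x h1
    rw [deriv_const_mul c h1, mul_assoc]
  have e2 : nonlocalForm K (fun x => c * a x) b = c * nonlocalForm K a b := by
    rw [nonlocalForm, nonlocalForm, mul_left_comm c]
    congr 1
    rw [← integral_const_mul]
    congr 1 with p
    ring
  rw [mixedForm, mixedForm, e1, e2]
  ring

theorem mixedForm_comm (η : ℝ) (K a b : ℝ → ℝ) : mixedForm η K a b = mixedForm η K b a := by
  simp only [mixedForm, nonlocalForm, mul_comm (deriv a _) (deriv b _),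
    mul_comm (a _ - a _) (b _ - b _)]

theorem mixedForm_add_left {η : ℝ} {K a b c : ℝ → ℝ} (hK : IsLevyKernel K)
    (ha : IsBoundedDirichlet a) (hb : IsBoundedDirichlet b) (hc : IsBoundedDirichlet c)
    (hc1 : Integrable c) :
    mixedForm η K (fun x => a x + b x) c = mixedForm η K a c + mixedForm η K b c :=
  mixedForm_add ha hb hc (ha.integrable_diff_mul_diff hc hc1 hK)
    (hb.integrable_diff_mul_diff hc hc1 hK)

theorem mixedForm_add_right {η : ℝ} {K a b c : ℝ → ℝ} (hK : IsLevyKernel K)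
    (ha : IsBoundedDirichlet a) (hb : IsBoundedDirichlet b) (hb1 : Integrable b)
    (hc : IsBoundedDirichlet c) (hc1 : Integrable c) :
    mixedForm η K a (fun x => b x + c x) = mixedForm η K a b + mixedForm η K a c := by
  rw [mixedForm_comm η K a, mixedForm_comm η K a, mixedForm_comm η K a]
  refine mixedForm_add hb hc ha ?_ ?_
  · simpa only [mul_comm (a _ - a _)] using ha.integrable_diff_mul_diff hb hb1 hK
  · simpa only [mul_comm (a _ - a _)] using ha.integrable_diff_mul_diff hc hc1 hK

theorem mixedForm_neg_left {η : ℝ} {K a b : ℝ → ℝ} (ha : IsBoundedDirichlet a) :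
    mixedForm η K (fun x => -a x) b = -mixedForm η K a b := by
  simpa using mixedForm_const_mul_left (η := η) (K := K) (b := b) (-1) ha

/-- Both integrands are pointwise nonnegative, because `t ↦ t⁺` is nondecreasing. This sign is what
makes truncated variations effective. -/
theorem mixedForm_max_zero_nonneg {η : ℝ} {K q : ℝ → ℝ} (hη : 0 ≤ η) (hK : IsLevyKernel K)
    (hq : IsBoundedDirichlet q) : 0 ≤ mixedForm η K q (fun x => max (q x) 0) := by
  refine add_nonneg (mul_nonneg hη (integral_nonneg_of_ae ?_))
    (mul_nonneg (by norm_num) (integral_nonneg_of_ae ?_))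
  · filter_upwards [hq.ae_differentiableAt] with x hx using deriv_mul_deriv_max_zero_nonneg hx
  · filter_upwards [hK.ae_nonneg_snd] with p hp
      using mul_nonneg (mul_max_zero_sub_nonneg _ _) hp

theorem integrable_mul_symmOp {a b K : ℝ → ℝ} (h : Integrable (fun p : ℝ × ℝ =>
      a p.1 * ((2 * b p.1 - b (p.1 + p.2) - b (p.1 - p.2)) * K p.2))) :
    Integrable (fun x => a x * symmOp K b x) := by
  refine (h.integral_prod_left.const_mul (1 / 2)).congr (ae_of_all _ fun x => ?_)
  simp only [integral_const_mul, symmOp]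
  ring

theorem IsBoundedC2.integrable_mul_deriv_two {B : ℝ} {b p : ℝ → ℝ} (hb : IsBoundedC2 B b)
    (hp1 : Integrable p) : Integrable (fun x => deriv (deriv b) x * p x) :=
  hp1.bdd_mul (measurable_deriv _).aestronglyMeasurable (ae_of_all _ hb.bound_two)

/-- Integration by parts in the mixed form against a compactly supported function. -/
theorem IsBoundedC2.mixedForm_eq {η B : ℝ} {b p K : ℝ → ℝ} (hb : IsBoundedC2 B b)
    (hbD : IsBoundedDirichlet b) (hK : IsLevyKernel K) (hp : IsBoundedDirichlet p)
    (hpc : HasCompactSupport p) :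
    Integrable (fun x => p x * (-η * deriv (deriv b) x + symmOp K b x)) ∧
    mixedForm η K b p = ∫ x, p x * (-η * deriv (deriv b) x + symmOp K b x) := by
  have hp1 : Integrable p := hp.continuous.integrable_of_hasCompactSupport hpc
  have h2 := hb.integrable_mul_second_diff hp.continuous hp1 hK
  have hd : ∀ x y, AbsolutelyContinuousOnInterval (deriv b) x y :=
    absolutelyContinuousOnInterval_of_contDiff
      ((contDiff_succ_iff_deriv (n := 1)).1 hb.contDiff).2.2
  have e1 := integral_mul_deriv_eq_neg_of_hasCompactSupport hd hp.ac hpc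
  have e2 : nonlocalForm K b p = ∫ x, p x * symmOp K b x := by
    rw [← nonlocalForm_eq_integral_mul_symmOp _ h2 fun z => ?_, nonlocalForm, nonlocalForm]
    · congr 2 with x
      ring
    · refine (hbD.integrable_diff_mul_diff hp hp1 hK).congr (ae_of_all _ fun x => ?_)
      ring
    · have hc := hb.contDiff.continuous
      refine hp1.mul_bdd (c := 2 * B) (by fun_prop : Continuous _).aestronglyMeasurable
        (ae_of_all _ fun x => ?_)
      have := abs_sub (b x) (b (x + z))
      rw [Real.norm_eq_abs]
      linarith [hb.bound x, hb.bound (x + z)]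
  have i1 : Integrable (fun x => -η * (deriv (deriv b) x * p x)) :=
    (hb.integrable_mul_deriv_two hp1).const_mul _
  have i2 := integrable_mul_symmOp h2
  have e : (fun x => p x * (-η * deriv (deriv b) x + symmOp K b x)) =
      fun x => -η * (deriv (deriv b) x * p x) + p x * symmOp K b x := by
    ext x; ring
  rw [e]
  refine ⟨i1.add i2, ?_⟩
  rw [integral_add i1 i2, mixedForm, e1, e2, integral_const_mul]
  ring

/-! ### The Lewy–Stampacchia argument. -/

/-- The one-sided Lewy–Stampacchia estimate: if `u` lies above the obstacle `ψ` and the mixed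
operator of `u` is at most `M` against every truncated variation that keeps `u` above `ψ`, and the
mixed operator of `ψ` is at most `M` on the support of `φ`, then it is at most `M` against `φ`. -/
theorem mixedForm_le_of_obstacle {η B C M : ℝ} {K u ψ φ : ℝ → ℝ} (hη : 0 ≤ η)
    (hK : IsLevyKernel K) (hu : IsBoundedDirichlet u) (hψ : IsBoundedC2 B ψ)
    (hψD : IsBoundedDirichlet ψ) (hφ : IsBoundedC2 C φ) (hφc : HasCompactSupport φ)
    (hφ0 : ∀ x, 0 ≤ φ x) (hψu : ∀ x, ψ x ≤ u x)
    (hM : ∀ x, φ x ≠ 0 → -η * deriv (deriv ψ) x + symmOp K ψ x ≤ M)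
    (hvi : ∀ ε > 0, mixedForm η K u (fun x => ε * φ x - max (ε * φ x - (u x - ψ x)) 0) ≤
      M * ∫ x, (ε * φ x - max (ε * φ x - (u x - ψ x)) 0)) :
    mixedForm η K u φ ≤ M * ∫ x, φ x := by
  have hφD : IsBoundedDirichlet φ := hφ.isBoundedDirichlet hφc.deriv
  have hφ1 : Integrable φ := hφ.contDiff.continuous.integrable_of_hasCompactSupport hφc
  set L := ∫ z, min 1 (z ^ 2) * K z
  set D := η * C + 2 * C * L
  have hφop : ∀ x, -η * deriv (deriv φ) x + symmOp K φ x ≤ D := fun x => by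
    have h1 := (abs_le.1 (hφ.abs_symmOp_le hK x)).2
    have h2 := mul_le_mul_of_nonneg_left (abs_le.1 (hφ.bound_two x)).1 hη
    simp only [D, L]
    linarith
  have hD : 0 ≤ D := by
    have hC := hφ.bound_nonneg
    have : 0 ≤ L := integral_nonneg_of_ae (by
      filter_upwards [hK.ae_nonneg] with z hz
      exact mul_nonneg (by positivity) hz)
    positivity
  have key : ∀ ε > 0, mixedForm η K u φ ≤ M * (∫ x, φ x) + ε * (D * ∫ x, φ x) := by
    intro ε hε
    set q : ℝ → ℝ := fun x => ε * φ x - (u x - ψ x) with hq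
    -- The excess of `ε φ` over the gap `u - ψ`; thus `ε φ - p = min (ε φ) (u - ψ)`.
    set p : ℝ → ℝ := fun x => max (q x) 0 with hp
    have hεφ : IsBoundedDirichlet (fun x => ε * φ x) := hφD.const_mul ε
    have hqD : IsBoundedDirichlet q := hεφ.sub (hu.sub hψD)
    have hpD : IsBoundedDirichlet p := hqD.max_zero
    have hp0 : ∀ x, 0 ≤ p x := fun x => le_max_right _ _
    have hpφ : ∀ x, p x ≤ ε * φ x := fun x =>
      max_le (by simp only [hq]; linarith [hψu x]) (mul_nonneg hε.le (hφ0 x))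
    have hpz : ∀ x, φ x = 0 → p x = 0 := fun x hx =>
      le_antisymm (by simpa [hx] using hpφ x) (hp0 x)
    have hpc : HasCompactSupport p := hφc.mono fun x hx hφx => hx (hpz x hφx)
    have hp1 : Integrable p := hpD.continuous.integrable_of_hasCompactSupport hpc
    have hgD : IsBoundedDirichlet (fun x => ε * φ x - p x) := hεφ.sub hpD
    have hεφ1 : Integrable (fun x => ε * φ x) := hφ1.const_mul ε
    obtain ⟨iψ, eψ⟩ := hψ.mixedForm_eq (η := η) hψD hK hpD hpc
    obtain ⟨iφ, eφ⟩ := hφ.mixedForm_eq (η := η) hφD hK hpD hpc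
    have hψp : mixedForm η K ψ p ≤ M * ∫ x, p x := by
      rw [eψ, ← integral_const_mul]
      refine integral_mono iψ (hp1.const_mul M) fun x => ?_
      by_cases hx : φ x = 0
      · simp [hpz x hx]
      · simp only
        rw [mul_comm M]
        exact mul_le_mul_of_nonneg_left (hM x hx) (hp0 x)
    -- The bound `p ≤ ε φ` supplies one power of `ε`; the coefficient of `φ` in `q` supplies a
    -- second, so the error survives division by `ε` as `O(ε)`.
    have hφp : mixedForm η K φ p ≤ ε * (D * ∫ x, φ x) := by
      rw [eφ, ← integral_const_mul, ← integral_const_mul]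
      refine integral_mono iφ ((hφ1.const_mul D).const_mul ε) fun x => ?_
      calc p x * (-η * deriv (deriv φ) x + symmOp K φ x) ≤ p x * D :=
            mul_le_mul_of_nonneg_left (hφop x) (hp0 x)
        _ ≤ ε * φ x * D := mul_le_mul_of_nonneg_right (hpφ x) hD
        _ = _ := by ring
    -- From `q + u = ε φ + ψ`; since the `q` term is nonnegative, this bounds the `u` term from
    -- above.
    have hdec : mixedForm η K q p + mixedForm η K u p =
        ε * mixedForm η K φ p + mixedForm η K ψ p := by
      rw [← mixedForm_const_mul_left ε hφD, ← mixedForm_add_left hK hqD hu hpD hp1,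
        ← mixedForm_add_left hK hεφ hψD hpD hp1]
      congr 1 with x
      simp only [hq]
      ring
    have hsplit : mixedForm η K u (fun x => ε * φ x - p x) + mixedForm η K u p =
        ε * mixedForm η K u φ := by
      rw [mixedForm_comm η K u φ, ← mixedForm_const_mul_left ε hφD, mixedForm_comm η K _ u,
        ← mixedForm_add_right hK hu hgD (hεφ1.sub hp1) hpD hp1]
      simp only [sub_add_cancel]
    have hpos := mixedForm_max_zero_nonneg hη hK hqD
    have hint : (∫ x, (ε * φ x - p x)) + ∫ x, p x = ε * ∫ x, φ x := by
      rw [integral_sub hεφ1 hp1, integral_const_mul]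
      ring
    have := hvi ε hε
    have hM' : M * (∫ x, (ε * φ x - p x)) + M * ∫ x, p x = ε * (M * ∫ x, φ x) := by
      rw [← mul_add, hint]; ring
    have hfin : ε * mixedForm η K u φ ≤
        ε * (M * (∫ x, φ x) + ε * (D * ∫ x, φ x)) := by
      have h3 := mul_le_mul_of_nonneg_left hφp hε.le
      change mixedForm η K u (fun x => ε * φ x - p x) ≤ M * ∫ x, (ε * φ x - p x) at this
      change 0 ≤ mixedForm η K q p at hpos
      linarith
    exact le_of_mul_le_mul_left hfin hε
  have hlim : Tendsto (fun ε : ℝ => M * (∫ x, φ x) + ε * (D * ∫ x, φ x)) (𝓝[>] 0)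
      (𝓝 (M * ∫ x, φ x)) := by
    have : Continuous (fun ε : ℝ => M * (∫ x, φ x) + ε * (D * ∫ x, φ x)) := by fun_prop
    simpa using (this.tendsto 0).mono_left nhdsWithin_le_nhds
  exact ge_of_tendsto hlim (by filter_upwards [self_mem_nhdsWithin] with ε hε using key ε hε)

/-! ### Weak derivatives and absolutely continuous representatives. -/

theorem exists_compactlySupported_primitive {χ : ℝ → ℝ} (hχ : ContDiff ℝ ∞ χ)
    (hχc : HasCompactSupport χ) (hχ0 : ∫ x, χ x = 0) :
    ∃ F : ℝ → ℝ, ContDiff ℝ ∞ F ∧ HasCompactSupport F ∧ deriv F = χ := by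
  obtain ⟨R, hR⟩ := hχc.isCompact.isBounded.exists_norm_le
  have hz : ∀ x, R < |x| → χ x = 0 := fun x hx => by
    by_contra hne
    exact absurd (hR x (subset_tsupport _ hne)) (not_le.2 hx)
  have hder : ∀ x, HasDerivAt (fun x => ∫ t in (-(R + 1))..x, χ t) (χ x) x := fun x =>
    intervalIntegral.integral_hasDerivAt_right (hχ.continuous.intervalIntegrable _ _)
      (hχ.continuous.stronglyMeasurableAtFilter _ _) hχ.continuous.continuousAt
  have hd : deriv (fun x => ∫ t in (-(R + 1))..x, χ t) = χ := funext fun x => (hder x).deriv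
  refine ⟨_, ?_, ?_, hd⟩
  · rw [contDiff_infty_iff_deriv, hd]
    exact ⟨fun x => (hder x).differentiableAt, hχ⟩
  · refine HasCompactSupport.intro (isCompact_Icc (a := -(R + 1)) (b := R + 1)) fun x hx => ?_
    rcases lt_or_ge x (-(R + 1)) with h | h
    · refine (intervalIntegral.integral_congr (g := fun _ => 0) fun t ht => hz t ?_).trans (by simp)
      rw [uIcc_of_ge h.le] at ht
      linarith [neg_le_abs t, ht.2]
    · have h' : R + 1 < x := by
        by_contra hcon
        exact hx ⟨h, not_lt.1 hcon⟩
      rw [intervalIntegral.integral_eq_integral_of_support_subset, hχ0]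
      intro t ht
      have := abs_le.1 (not_lt.1 fun hlt => ht (hz t hlt))
      exact ⟨by linarith, by linarith⟩

theorem integrable_mul_of_hasCompactSupport {h φ : ℝ → ℝ} (hh : LocallyIntegrable h)
    (hφ : Continuous φ) (hφc : HasCompactSupport φ) : Integrable (fun x => h x * φ x) := by
  simpa [mul_comm] using hh.integrable_smul_left_of_hasCompactSupport hφ hφc

/-- A locally integrable function with zero weak derivative is constant. -/
theorem ae_eq_const_of_integral_mul_deriv_eq_zero {h : ℝ → ℝ} (hh : LocallyIntegrable h)
    (h0 : ∀ φ : ℝ → ℝ, ContDiff ℝ ∞ φ → HasCompactSupport φ → ∫ x, h x * deriv φ x = 0) :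
    ∃ c, ∀ᵐ x, h x = c := by
  let f : ContDiffBump (0 : ℝ) := ⟨1, 2, by norm_num, by norm_num⟩
  set ρ : ℝ → ℝ := f.normed volume
  have hρ : ContDiff ℝ ∞ ρ := f.contDiff_normed
  have hρc : HasCompactSupport ρ := f.hasCompactSupport_normed
  have hρ1 : ∫ x, ρ x = 1 := f.integral_normed
  have hρi : Integrable ρ := hρ.continuous.integrable_of_hasCompactSupport hρc
  -- Subtracting `(∫ ψ) ρ` from `ψ` leaves mean zero, hence the derivative of a test function, which
  -- `h` annihilates. So `h` acts on `ψ` as the constant `∫ h ρ`.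
  refine ⟨∫ x, h x * ρ x, ae_eq_of_integral_contDiff_smul_eq hh (locallyIntegrable_const _)
    fun ψ hψ hψc => ?_⟩
  have hψi : Integrable ψ := hψ.continuous.integrable_of_hasCompactSupport hψc
  obtain ⟨F, hF, hFc, hFd⟩ := exists_compactlySupported_primitive
    (χ := fun x => ψ x - (∫ y, ψ y) * ρ x) (hψ.sub (contDiff_const.mul hρ))
    (hψc.sub hρc.mul_left) (by
      rw [integral_sub hψi (hρi.const_mul _), integral_const_mul, hρ1]; ring)
  have key := h0 F hF hFc
  have i1 := integrable_mul_of_hasCompactSupport hh hψ.continuous hψc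
  have i2 := integrable_mul_of_hasCompactSupport hh hρ.continuous hρc
  have e : (fun x => h x * deriv F x) =
      fun x => h x * ψ x - (∫ y, ψ y) * (h x * ρ x) := by
    ext x
    rw [hFd]
    ring
  rw [e, integral_sub i1 (i2.const_mul _), integral_const_mul] at key
  simp only [smul_eq_mul, integral_mul_const]
  simp only [mul_comm (ψ _)]
  linarith

theorem HasWeakDeriv.congr {g h g' : ℝ → ℝ} (hg : HasWeakDeriv g g') (e : g =ᵐ[volume] h) :
    HasWeakDeriv h g' := by
  refine ⟨hg.1.congr e, hg.2.1, fun φ hφ hφc => ?_⟩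
  rw [← hg.2.2 φ hφ hφc]
  refine integral_congr_ae ?_
  filter_upwards [e] with x hx
  rw [hx]

theorem HasWeakDeriv.neg {g g' : ℝ → ℝ} (hg : HasWeakDeriv g g') :
    HasWeakDeriv (fun x => -g x) (fun x => -g' x) := by
  refine ⟨hg.1.neg, hg.2.1.neg, fun φ hφ hφc => ?_⟩
  simp only [neg_mul, integral_neg, hg.2.2 φ hφ hφc]

theorem HasWeakDeriv.unique {g g₁ g₂ : ℝ → ℝ} (h₁ : HasWeakDeriv g g₁)
    (h₂ : HasWeakDeriv g g₂) : g₁ =ᵐ[volume] g₂ := by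
  refine ae_eq_of_integral_contDiff_smul_eq h₁.2.1 h₂.2.1 fun φ hφ hφc => ?_
  simp only [smul_eq_mul, mul_comm (φ _)]
  rw [← neg_inj, ← h₁.2.2 φ hφ hφc, h₂.2.2 φ hφ hφc]

theorem HasWeakDeriv.weakDeriv_ae_eq {g g' : ℝ → ℝ} (h : HasWeakDeriv g g') :
    weakDeriv g =ᵐ[volume] g' := by
  have hex : ∃ g', HasWeakDeriv g g' := ⟨g', h⟩
  rw [weakDeriv, dif_pos hex]
  exact hex.choose_spec.unique h

theorem hasWeakDeriv_deriv {a : ℝ → ℝ} (ha : ∀ x y, AbsolutelyContinuousOnInterval a x y)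
    (hd : LocallyIntegrable (deriv a)) : HasWeakDeriv a (deriv a) :=
  ⟨(continuous_of_absolutelyContinuousOnInterval ha).locallyIntegrable, hd, fun _ hφ hφc =>
    integral_mul_deriv_eq_neg_of_hasCompactSupport ha
      (absolutelyContinuousOnInterval_of_contDiff (hφ.of_le (by simp))) hφc⟩

theorem IsBoundedDirichlet.hasWeakDeriv {a : ℝ → ℝ} (ha : IsBoundedDirichlet a) :
    HasWeakDeriv a (deriv a) :=
  hasWeakDeriv_deriv ha.ac (ha.memLp.locallyIntegrable (by norm_num))

/-- A function with a weak derivative has a locally absolutely continuous representative. -/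
theorem HasWeakDeriv.exists_absolutelyContinuous {w w' : ℝ → ℝ} (h : HasWeakDeriv w w') :
    ∃ a : ℝ → ℝ, (∀ x y, AbsolutelyContinuousOnInterval a x y) ∧ w =ᵐ[volume] a ∧
      deriv a =ᵐ[volume] w' := by
  set G : ℝ → ℝ := fun x => ∫ t in (0 : ℝ)..x, w' t with hG
  have hac : ∀ x y, AbsolutelyContinuousOnInterval G x y := fun x y => by
    -- The interval is enlarged to contain the base point `0` of the primitive.
    have hi : IntervalIntegrable w' volume (min 0 (min x y)) (max 0 (max x y)) :=
      intervalIntegrable_iff.2 ((h.2.1.integrableOn_isCompact isCompact_uIcc).mono_set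
        uIoc_subset_uIcc)
    have hle : min 0 (min x y) ≤ max 0 (max x y) := (min_le_left _ _).trans (le_max_left _ _)
    refine (hi.absolutelyContinuousOnInterval_intervalIntegral (c := 0) ?_).mono ?_
    · rw [uIcc_of_le hle]
      exact ⟨min_le_left _ _, le_max_left _ _⟩
    · rw [uIcc_of_le hle]
      exact Icc_subset_Icc (min_le_right _ _) (le_max_right _ _)
  have hdG : deriv G =ᵐ[volume] w' := by
    filter_upwards [LocallyIntegrable.ae_hasDerivAt_integral h.2.1] with x hx using (hx 0).deriv
  have hGw : HasWeakDeriv G (deriv G) := hasWeakDeriv_deriv hac (h.2.1.congr hdG.symm)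
  obtain ⟨c, hc⟩ := ae_eq_const_of_integral_mul_deriv_eq_zero (h := fun x => w x - G x)
    (h.1.sub hGw.1) fun φ hφ hφc => by
      have hφ' : Continuous (deriv φ) := hφ.continuous_deriv (by simp)
      simp only [sub_mul]
      rw [integral_sub (integrable_mul_of_hasCompactSupport h.1 hφ' hφc.deriv)
        (integrable_mul_of_hasCompactSupport hGw.1 hφ' hφc.deriv), h.2.2 φ hφ hφc,
        hGw.2.2 φ hφ hφc, sub_eq_zero, neg_inj]
      refine integral_congr_ae ?_
      filter_upwards [hdG] with x hx
      rw [hx]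
  refine ⟨fun x => G x + c, fun x y => (hac x y).fun_add
    (absolutelyContinuousOnInterval_of_contDiff contDiff_const x y), ?_, ?_⟩
  · filter_upwards [hc] with x hx
    linarith
  · filter_upwards [hdG] with x hx
    rw [deriv_add_const, hx]

theorem le_of_ae_le_of_continuous {a b : ℝ → ℝ} (ha : Continuous a) (hb : Continuous b)
    (h : ∀ᵐ x, a x ≤ b x) (x : ℝ) : a x ≤ b x := by
  have : (fun x => max (a x) (b x)) = b := by
    refine ((ha.max hb).ae_eq_iff_eq volume hb).1 ?_
    filter_upwards [h] with x hx using max_eq_right hx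
  exact max_eq_right_iff.1 (congrFun this x)

/-! ### Obstacles, admissible functions and transfer to representatives. -/

theorem IsTransition.isObstacle {ζ₁ ζ₂ : ℝ} {Qs : ℝ → ℝ} (h : IsTransition ζ₁ ζ₂ Qs) :
    IsObstacle ζ₁ ζ₂ Qs where
  smooth := h.smooth
  eq_left := (eventually_lt_atBot (-1)).mono h.eq_left
  eq_right := (eventually_gt_atTop 1).mono h.eq_right

theorem IsObstacle.neg {c₁ c₂ : ℝ} {b : ℝ → ℝ} (h : IsObstacle c₁ c₂ b) :
    IsObstacle (-c₁) (-c₂) (fun x => -b x) where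
  smooth := h.smooth.neg
  eq_left := h.eq_left.mono fun _ hx => by rw [hx]
  eq_right := h.eq_right.mono fun _ hx => by rw [hx]

theorem IsObstacle.exists_isBoundedC2 {c₁ c₂ : ℝ} {b : ℝ → ℝ} (h : IsObstacle c₁ c₂ b) :
    HasCompactSupport (deriv b) ∧ ∃ B, IsBoundedC2 B b := by
  obtain ⟨l, hl⟩ := eventually_atBot.1 h.eq_left
  obtain ⟨m, hm⟩ := eventually_atTop.1 h.eq_right
  have hc : HasCompactSupport (deriv b) := by
    refine HasCompactSupport.intro (isCompact_Icc (a := l) (b := m)) fun x hx => ?_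
    rcases lt_or_ge x l with h1 | h1
    · have : b =ᶠ[𝓝 x] fun _ => c₁ := by
        filter_upwards [eventually_lt_nhds h1] with y hy using hl y hy.le
      rw [this.deriv_eq, deriv_const]
    · have h2 : m < x := by
        by_contra hcon
        exact hx ⟨h1, not_lt.1 hcon⟩
      have : b =ᶠ[𝓝 x] fun _ => c₂ := by
        filter_upwards [eventually_gt_nhds h2] with y hy using hm y hy.le
      rw [this.deriv_eq, deriv_const]
  refine ⟨hc, ?_⟩
  have hd : ContDiff ℝ ∞ (deriv b) := (contDiff_infty_iff_deriv.1 h.smooth).2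
  have hdd : ContDiff ℝ ∞ (deriv (deriv b)) := (contDiff_infty_iff_deriv.1 hd).2
  obtain ⟨B₂, hB₂⟩ := hc.deriv.exists_bound_of_continuous hdd.continuous
  obtain ⟨B₁, hB₁⟩ := (isCompact_Icc (a := l) (b := m)).exists_bound_of_continuousOn
    h.smooth.continuous.continuousOn
  refine ⟨max (max B₁ B₂) (max |c₁| |c₂|), contDiff_infty.1 h.smooth 2, fun x => ?_,
    fun x => (hB₂ x).trans ((le_max_right _ _).trans (le_max_left _ _))⟩
  rcases lt_or_ge x l with h1 | h1
  · rw [hl x h1.le]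
    exact (le_max_left _ _).trans (le_max_right _ _)
  · rcases lt_or_ge m x with h2 | h2
    · rw [hm x h2.le]
      exact (le_max_right _ _).trans (le_max_right _ _)
    · exact (hB₁ x ⟨h1, h2⟩).trans ((le_max_left _ _).trans (le_max_left _ _))

theorem IsTestFunction.exists_isBoundedC2 {I : Set ℝ} {φ : ℝ → ℝ} (h : IsTestFunction I φ) :
    ∃ C, IsBoundedC2 C φ := by
  have hd : ContDiff ℝ ∞ (deriv φ) := (contDiff_infty_iff_deriv.1 h.smooth).2
  have hdd : ContDiff ℝ ∞ (deriv (deriv φ)) := (contDiff_infty_iff_deriv.1 hd).2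
  obtain ⟨B₁, hB₁⟩ := h.compact_support.exists_bound_of_continuous h.smooth.continuous
  obtain ⟨B₂, hB₂⟩ := h.compact_support.deriv.deriv.exists_bound_of_continuous hdd.continuous
  exact ⟨max B₁ B₂, contDiff_infty.1 h.smooth 2,
    fun x => (hB₁ x).trans (le_max_left _ _), fun x => (hB₂ x).trans (le_max_right _ _)⟩

/-- Every admissible function has a bounded, locally absolutely continuous representative. -/
theorem exists_isBoundedDirichlet_of_mem_admissible {c₁ c₂ c₃ c₄ c₅ c₆ : ℝ} {Qs Ψ Φ u : ℝ → ℝ}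
    (hQs : IsObstacle c₁ c₂ Qs) (hΨ : IsObstacle c₃ c₄ Ψ) (hΦ : IsObstacle c₅ c₆ Φ)
    (hu : u ∈ admissible Qs Ψ Φ) :
    ∃ U, IsBoundedDirichlet U ∧ u =ᵐ[volume] U := by
  obtain ⟨⟨-, w', hw, hw'⟩, hb⟩ := hu
  obtain ⟨a, ha, hwa, hda⟩ := hw.exists_absolutelyContinuous
  obtain ⟨hQc, BQ, hQ⟩ := hQs.exists_isBoundedC2
  obtain ⟨-, B₁, hΨB⟩ := hΨ.exists_isBoundedC2
  obtain ⟨-, B₂, hΦB⟩ := hΦ.exists_isBoundedC2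
  have hQD := hQ.isBoundedDirichlet hQc
  have hac : ∀ x y, AbsolutelyContinuousOnInterval (fun x => a x + Qs x) x y := fun x y =>
    (ha x y).fun_add (hQD.ac x y)
  have hcont := continuous_of_absolutelyContinuousOnInterval hac
  have hu : u =ᵐ[volume] fun x => a x + Qs x := by
    filter_upwards [hwa] with x hx
    linarith
  refine ⟨fun x => a x + Qs x, ⟨hac, ?_, B₁ + B₂, fun x => ?_⟩, hu⟩
  · refine (memLp_congr_ae ?_).2 (hw'.add hQD.memLp)
    filter_upwards [hda, ae_differentiableAt_of_absolutelyContinuousOnInterval ha,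
      hQD.ae_differentiableAt] with x h1 h2 h3
    rw [deriv_fun_add h2 h3, h1, Pi.add_apply]
  -- Boundedness comes from the obstacles: the constraints hold a.e. for the representative, hence
  -- everywhere by continuity.
  · have h1 := le_of_ae_le_of_continuous hΨ.smooth.continuous hcont
      (by filter_upwards [hu] with y hy using hy ▸ (hb y).1) x
    have h2 := le_of_ae_le_of_continuous hcont hΦ.smooth.continuous
      (by filter_upwards [hu] with y hy using hy ▸ (hb y).2) x
    have h3 := abs_le.1 (hΨB.bound x)
    have h4 := abs_le.1 (hΦB.bound x)
    rw [abs_le]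
    constructor <;> linarith [hΨB.bound_nonneg, hΦB.bound_nonneg]

/-- The measure-preserving shear `y = x + z` and evenness of `K` give the nonlocal part; a.e.
equalities pull back along both coordinates of the shear. -/
theorem energyForm_eq_mixedForm {η : ℝ} {K u v U V : ℝ → ℝ} (hK : IsLevyKernel K)
    (hU : IsBoundedDirichlet U) (hV : IsBoundedDirichlet V) (hu : u =ᵐ[volume] U)
    (hv : v =ᵐ[volume] V) : energyForm η K u v = mixedForm η K U (fun x => U x - V x) := by
  have e1 : ∫ x, weakDeriv u x * (weakDeriv u x - weakDeriv v x) =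
      ∫ x, deriv U x * deriv (fun x => U x - V x) x := by
    refine integral_congr_ae ?_
    filter_upwards [(hU.hasWeakDeriv.congr hu.symm).weakDeriv_ae_eq,
      (hV.hasWeakDeriv.congr hv.symm).weakDeriv_ae_eq, hU.ae_differentiableAt,
      hV.ae_differentiableAt] with x h1 h2 h3 h4
    rw [h1, h2, deriv_fun_sub h3 h4]
  have e2 : ∫ p : ℝ × ℝ, (u p.1 - u p.2) * ((u p.1 - v p.1) - (u p.2 - v p.2)) * K (p.1 - p.2) =
      ∫ p : ℝ × ℝ, (U p.1 - U (p.1 + p.2)) *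
        ((U p.1 - V p.1) - (U (p.1 + p.2) - V (p.1 + p.2))) * K p.2 := by
    have hmp : MeasurePreserving (fun p : ℝ × ℝ => (p.1, p.1 + p.2)) volume volume :=
      measurePreserving_prod_add volume volume
    rw [← hmp.integral_comp (MeasurableEquiv.shearAddRight ℝ).measurableEmbedding]
    have hfst : Measure.QuasiMeasurePreserving (fun p : ℝ × ℝ => p.1) volume volume :=
      Measure.quasiMeasurePreserving_fst
    have hsnd : Measure.QuasiMeasurePreserving (fun p : ℝ × ℝ => p.1 + p.2) volume volume :=
      Measure.quasiMeasurePreserving_snd.comp hmp.quasiMeasurePreserving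
    refine integral_congr_ae ?_
    filter_upwards [hfst.ae hu, hfst.ae hv, hsnd.ae hu, hsnd.ae hv] with p h1 h2 h3 h4
    rw [h1, h2, h3, h4, show p.1 - (p.1 + p.2) = -p.2 by ring, hK.even]
  rw [energyForm, e1, e2, mixedForm, nonlocalForm]

/-- The operators fall on the smooth compactly supported `φ`, so boundedness of `U` suffices for the
nonlocal integrals. -/
theorem distribPairing_eq_mixedForm {η : ℝ} {K u U φ : ℝ → ℝ} {I : Set ℝ} (hK : IsLevyKernel K)
    (hU : IsBoundedDirichlet U) (hu : u =ᵐ[volume] U) (hφ : IsTestFunction I φ) :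
    Integrable (fun x => u x * nonlocalOp K φ x) ∧ distribPairing η K u φ = mixedForm η K U φ := by
  obtain ⟨C, hC⟩ := hφ.exists_isBoundedC2
  obtain ⟨A, hA⟩ := hU.bounded
  have hφD := hC.isBoundedDirichlet hφ.compact_support.deriv
  have hφ1 := hφD.continuous.integrable_of_hasCompactSupport (μ := volume) hφ.compact_support
  have h2 := hC.integrable_bounded_mul_second_diff hφ.compact_support hU.continuous hA hK
  have e2 : nonlocalForm K U φ = ∫ x, U x * symmOp K φ x :=
    nonlocalForm_eq_integral_mul_symmOp (hU.integrable_diff_mul_diff hφD hφ1 hK) h2 fun z =>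
      (hφ1.sub (hφ1.comp_add_right z)).bdd_mul hU.continuous.aestronglyMeasurable (ae_of_all _ hA)
  have hd : ContDiff ℝ ∞ (deriv φ) := (contDiff_infty_iff_deriv.1 hφ.smooth).2
  have e1 : ∫ x, U x * deriv (deriv φ) x = -∫ x, deriv U x * deriv φ x :=
    hU.hasWeakDeriv.2.2 _ hd hφ.compact_support.deriv
  have hop : nonlocalOp K φ = symmOp K φ := funext fun x => hC.nonlocalOp_eq hK x
  have hcongr : (fun x => U x * symmOp K φ x) =ᵐ[volume] fun x => u x * nonlocalOp K φ x := by
    filter_upwards [hu] with x hx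
    rw [hx, hop]
  refine ⟨(integrable_mul_symmOp h2).congr hcongr, ?_⟩
  have e3 : ∫ x, u x * iteratedDeriv 2 φ x = ∫ x, U x * deriv (deriv φ) x := by
    refine integral_congr_ae ?_
    filter_upwards [hu] with x hx
    rw [hx, iteratedDeriv_succ, iteratedDeriv_one]
  rw [distribPairing, e3, e1, ← integral_congr_ae hcongr, mixedForm, e2]
  ring

theorem MemH1.neg {g : ℝ → ℝ} (hg : MemH1 g) : MemH1 (fun x => -g x) := by
  obtain ⟨h, g', hg', hm⟩ := hg
  exact ⟨h.neg, _, hg'.neg, hm.neg⟩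

theorem neg_mem_admissible {Qs Ψ Φ u : ℝ → ℝ} (hu : u ∈ admissible Qs Ψ Φ) :
    (fun x => -u x) ∈ admissible (fun x => -Qs x) (fun x => -Φ x) (fun x => -Ψ x) := by
  refine ⟨?_, fun x => ⟨neg_le_neg (hu.2 x).2, neg_le_neg (hu.2 x).1⟩⟩
  have e : (fun x => -u x - -Qs x) = fun x => -(u x - Qs x) := by
    ext x; ring
  rw [e]
  exact hu.1.neg

/-- Subtracting a compactly supported variation that keeps the function between the obstacles. -/
theorem sub_mem_admissible {c₁ c₂ : ℝ} {Qs Ψ Φ u U g g₀ : ℝ → ℝ} (hQs : IsObstacle c₁ c₂ Qs)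
    (hu : u ∈ admissible Qs Ψ Φ) (hU : IsBoundedDirichlet U) (huU : u =ᵐ[volume] U)
    (hg : IsBoundedDirichlet g) (hgc : HasCompactSupport g) (hg₀ : g₀ =ᵐ[volume] g)
    (h₁ : ∀ x, Ψ x ≤ u x - g₀ x) (h₂ : ∀ x, 0 ≤ g₀ x) :
    (fun x => u x - g₀ x) ∈ admissible Qs Ψ Φ := by
  obtain ⟨hQc, BQ, hQ⟩ := hQs.exists_isBoundedC2
  have hD := (hU.sub hg).sub (hQ.isBoundedDirichlet hQc)
  refine ⟨⟨?_, _, hD.hasWeakDeriv.congr ?_, hD.memLp⟩, fun x =>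
    ⟨h₁ x, (sub_le_self _ (h₂ x)).trans (hu.2 x).2⟩⟩
  · refine (memLp_congr_ae ?_).2
      (hu.1.1.sub (hg.continuous.memLp_of_hasCompactSupport hgc))
    filter_upwards [hg₀] with x hx
    rw [Pi.sub_apply, hx]
    ring
  · filter_upwards [huU, hg₀] with x h1 h2
    rw [h1, h2]

/-! ### The one-sided bound for solutions, and reflection. -/

theorem integral_mul_le_of_ae_le {I : Set ℝ} {f g : ℝ → ℝ} {M : ℝ}
    (hf : MemLp f ∞ (volume.restrict I)) (hM : ∀ᵐ x ∂volume.restrict I, f x ≤ M)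
    (hg : Integrable g) (hg0 : ∀ x, 0 ≤ g x) (hgI : ∀ x ∉ I, g x = 0) :
    ∫ x, f x * g x ≤ M * ∫ x, g x := by
  have e1 : ∫ x, f x * g x = ∫ x in I, f x * g x :=
    (setIntegral_eq_integral_of_forall_compl_eq_zero fun x hx => by rw [hgI x hx, mul_zero]).symm
  have e2 : ∫ x, g x = ∫ x in I, g x :=
    (setIntegral_eq_integral_of_forall_compl_eq_zero fun x hx => hgI x hx).symm
  have hgi : Integrable g (volume.restrict I) := hg.integrableOn
  rw [e1, e2, ← integral_const_mul]
  refine integral_mono_ae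
    (hgi.bdd_mul hf.aestronglyMeasurable (ae_le_lpNorm_exponent_top hf)) (hgi.const_mul M) ?_
  filter_upwards [hM] with x hx using mul_le_mul_of_nonneg_right hx (hg0 x)

/-- The competitor `max (u - ε φ) Ψ` lies between `Ψ` and `u` and equals `u` off `I`, so it is
admissible and supplies the hypothesis of `mixedForm_le_of_obstacle`. -/
theorem distribPairing_le {c₁ c₂ c₃ c₄ c₅ c₆ η M : ℝ} {K Qs Ψ Φ f u φ : ℝ → ℝ} {I : Set ℝ}
    (hK : IsLevyKernel K) (hQs : IsObstacle c₁ c₂ Qs) (hΨ : IsObstacle c₃ c₄ Ψ)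
    (hΦ : IsObstacle c₅ c₆ Φ) (hη : 0 < η ∧ η ≤ 1)
    (hf : MemLp f ∞ (volume.restrict I)) (hu : u ∈ admissible Qs Ψ Φ)
    (hvi : SolvesVariationalInequality η K Qs Ψ Φ I f u)
    (hM : ∀ x ∈ I, |iteratedDeriv 2 Ψ x| + nonlocalOp K Ψ x ≤ M)
    (hfM : ∀ᵐ x ∂volume.restrict I, f x ≤ M)
    (hφ : IsTestFunction I φ) (hφ0 : ∀ x, 0 ≤ φ x) :
    distribPairing η K u φ ≤ M * ∫ x, φ x := by
  obtain ⟨U, hU, huU⟩ := exists_isBoundedDirichlet_of_mem_admissible hQs hΨ hΦ hu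
  obtain ⟨hΨc, B, hB⟩ := hΨ.exists_isBoundedC2
  obtain ⟨C, hC⟩ := hφ.exists_isBoundedC2
  have hΨD := hB.isBoundedDirichlet hΨc
  have hφD := hC.isBoundedDirichlet hφ.compact_support.deriv
  have hφI : ∀ x, φ x ≠ 0 → x ∈ I := fun x hx =>
    interior_subset (hφ.support_subset (subset_tsupport _ hx))
  rw [(distribPairing_eq_mixedForm hK hU huU hφ).2]
  refine mixedForm_le_of_obstacle hη.1.le hK hU hB hΨD hC hφ.compact_support hφ0
    (le_of_ae_le_of_continuous hΨD.continuous hU.continuous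
      (by filter_upwards [huU] with x hx using hx ▸ (hu.2 x).1)) (fun x hx => ?_) fun ε hε => ?_
  · have h1 := hM x (hφI x hx)
    rw [iteratedDeriv_succ, iteratedDeriv_one, hB.nonlocalOp_eq hK] at h1
    -- Here `η ≤ 1` removes `η` from the bound.
    have h2 : -η * deriv (deriv Ψ) x ≤ |deriv (deriv Ψ) x| := by
      calc -η * deriv (deriv Ψ) x ≤ |-η * deriv (deriv Ψ) x| := le_abs_self _
        _ = η * |deriv (deriv Ψ) x| := by rw [abs_mul, abs_neg, abs_of_pos hη.1]
        _ ≤ _ := mul_le_of_le_one_left (abs_nonneg _) hη.2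
    linarith
  · set g : ℝ → ℝ := fun x => ε * φ x - max (ε * φ x - (U x - Ψ x)) 0
    -- Admissibility and equality off `I` are pointwise conditions, so the competitor is built from
    -- `u` itself; `g` is the regular representative of the variation.
    set g₀ : ℝ → ℝ := fun x => ε * φ x - max (ε * φ x - (u x - Ψ x)) 0
    have hg : IsBoundedDirichlet g :=
      (hφD.const_mul ε).sub ((hφD.const_mul ε).sub (hU.sub hΨD)).max_zero
    have hg₀ : g₀ =ᵐ[volume] g := by
      filter_upwards [huU] with x hx
      simp only [g₀, g, hx]
    have hz : ∀ w : ℝ → ℝ, (∀ x, Ψ x ≤ w x) → ∀ x, φ x = 0 →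
        ε * φ x - max (ε * φ x - (w x - Ψ x)) 0 = 0 := fun w hw x hx => by
      rw [hx, mul_zero, max_eq_right (by linarith [hw x]), sub_zero]
    have hΨU := le_of_ae_le_of_continuous hΨD.continuous hU.continuous
      (by filter_upwards [huU] with x hx using hx ▸ (hu.2 x).1)
    have hgc : HasCompactSupport g :=
      hφ.compact_support.mono fun x hx hφx => hx (hz U hΨU x hφx)
    have hg1 : Integrable g := hg.continuous.integrable_of_hasCompactSupport hgc
    have hg₀0 : ∀ x, 0 ≤ g₀ x := fun x => sub_nonneg.2
      (max_le (by linarith [(hu.2 x).1]) (mul_nonneg hε.le (hφ0 x)))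
    have hg₀I : ∀ x ∉ I, g₀ x = 0 := fun x hx =>
      hz u (fun x => (hu.2 x).1) x (by_contra fun hne => hx (hφI x hne))
    have hv : (fun x => u x - g₀ x) ∈ admissible Qs Ψ Φ :=
      sub_mem_admissible hQs hu hU huU hg hgc hg₀
        (fun x => by
          have := le_max_left (ε * φ x - (u x - Ψ x)) 0
          simp only [g₀]
          linarith) hg₀0
    have key := hvi _ hv fun x hx => by simp only [hg₀I x hx, sub_zero]
    have hvV : (fun x => u x - g₀ x) =ᵐ[volume] fun x => U x - g x := by
      filter_upwards [huU, hg₀] with x h1 h2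
      rw [h1, h2]
    rw [energyForm_eq_mixedForm hK hU (hU.sub hg) huU hvV] at key
    simp only [sub_sub_cancel] at key
    refine key.trans ?_
    rw [← integral_congr_ae hg₀]
    exact integral_mul_le_of_ae_le hf hfM ((integrable_congr hg₀).2 hg1) hg₀0 hg₀I

/-- The energy is even under changing the sign of both arguments. Representatives are used because
`weakDeriv` is a choice, so it commutes with negation only a.e. -/
theorem SolvesVariationalInequality.neg {c₁ c₂ c₃ c₄ c₅ c₆ η : ℝ} {K Qs Ψ Φ f u : ℝ → ℝ}
    {I : Set ℝ} (hK : IsLevyKernel K) (hQs : IsObstacle c₁ c₂ Qs) (hΨ : IsObstacle c₃ c₄ Ψ)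
    (hΦ : IsObstacle c₅ c₆ Φ) (hu : u ∈ admissible Qs Ψ Φ)
    (hvi : SolvesVariationalInequality η K Qs Ψ Φ I f u) :
    SolvesVariationalInequality η K (fun x => -Qs x) (fun x => -Φ x) (fun x => -Ψ x) I
      (fun x => -f x) (fun x => -u x) := by
  intro v hv hvu
  have hv' : (fun x => -v x) ∈ admissible Qs Ψ Φ := by
    simpa only [neg_neg] using neg_mem_admissible hv
  obtain ⟨U, hU, huU⟩ := exists_isBoundedDirichlet_of_mem_admissible hQs hΨ hΦ hu
  obtain ⟨V, hV, hvV⟩ := exists_isBoundedDirichlet_of_mem_admissible hQs hΨ hΦ hv'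
  have key := hvi _ hv' fun x hx => by simp only [hvu x hx, neg_neg]
  rw [energyForm_eq_mixedForm hK hU hV huU hvV] at key
  rw [energyForm_eq_mixedForm hK hU.neg hV.neg (U := fun x => -U x) (V := fun x => -V x)
    (by filter_upwards [huU] with x hx using congrArg Neg.neg hx)
    (by filter_upwards [hvV] with x hx using by rw [← hx, neg_neg])]
  have e : (fun x => -U x - -V x) = fun x => -(U x - V x) := by
    ext x; ring
  rw [e, mixedForm_neg_left hU, mixedForm_comm, mixedForm_neg_left (hU.sub hV), neg_neg,
    mixedForm_comm]
  refine key.trans_eq ?_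
  congr 1 with x
  ring

theorem nonlocalOp_neg {B : ℝ} {K b : ℝ → ℝ} (hb : IsBoundedC2 B b)
    (hb' : IsBoundedC2 B (fun x => -b x)) (hK : IsLevyKernel K) (x : ℝ) :
    nonlocalOp K (fun x => -b x) x = -nonlocalOp K b x := by
  rw [hb'.nonlocalOp_eq hK, hb.nonlocalOp_eq hK, symmOp_neg]

theorem IsBoundedC2.neg {B : ℝ} {b : ℝ → ℝ} (hb : IsBoundedC2 B b) :
    IsBoundedC2 B (fun x => -b x) where
  contDiff := hb.contDiff.neg
  bound x := by simpa using hb.bound x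
  bound_two x := by simpa [deriv.fun_neg'] using hb.bound_two x

end MixedObstacle

theorem proposition6p1
    (s θ₀ Θ₀ r₀ : ℝ) (hs : 1 / 4 < s ∧ s ≤ 1 / 2)
    (K : ℝ → ℝ) (hK : MixedObstacle.IsKernel s θ₀ Θ₀ r₀ K)
    (ζ₁ ζ₂ r : ℝ) (hr : 0 < r)
    (Qs : ℝ → ℝ) (hQs : MixedObstacle.IsTransition ζ₁ ζ₂ Qs)
    (Φ Ψ : ℝ → ℝ)
    (hΦ : MixedObstacle.IsObstacle (ζ₁ + r) (ζ₂ + r) Φ)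
    (hΨ : MixedObstacle.IsObstacle (ζ₁ - r) (ζ₂ - r) Ψ)
    (η : ℝ) (hη : 0 < η ∧ η ≤ 1)
    (I : Set ℝ) (hI : I.OrdConnected) (hIb : Bornology.IsBounded I)
    (f : ℝ → ℝ) (hf : MemLp f ∞ (volume.restrict I))
    (u : ℝ → ℝ) (hu : u ∈ MixedObstacle.admissible Qs Ψ Φ)
    (hvi : MixedObstacle.SolvesVariationalInequality η K Qs Ψ Φ I f u) :
    (∀ x ∈ I, MixedObstacle.HasPrincipalValue K Φ x ∧ MixedObstacle.HasPrincipalValue K Ψ x) ∧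
    BddBelow ((fun x => -|iteratedDeriv 2 Φ x| + MixedObstacle.nonlocalOp K Φ x) '' I) ∧
    BddAbove ((fun x => |iteratedDeriv 2 Ψ x| + MixedObstacle.nonlocalOp K Ψ x) '' I) ∧
    MixedObstacle.DistribBetween η K u I
      (min (sInf ((fun x => -|iteratedDeriv 2 Φ x| + MixedObstacle.nonlocalOp K Φ x) '' I))
        (essInf f (volume.restrict I)))
      (max (sSup ((fun x => |iteratedDeriv 2 Ψ x| + MixedObstacle.nonlocalOp K Ψ x) '' I))
        (essSup f (volume.restrict I))) := by
  have hL := hK.isLevyKernel (by linarith) hs.2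
  have hQ := hQs.isObstacle
  obtain ⟨-, A, hA⟩ := hΦ.exists_isBoundedC2
  obtain ⟨-, B, hB⟩ := hΨ.exists_isBoundedC2
  have hbelow : BddBelow
      ((fun x => -|iteratedDeriv 2 Φ x| + MixedObstacle.nonlocalOp K Φ x) '' I) := by
    refine ⟨-A + -(2 * A * ∫ z, min 1 (z ^ 2) * K z), ?_⟩
    rintro _ ⟨x, -, rfl⟩
    simp only [iteratedDeriv_succ, iteratedDeriv_zero, hA.nonlocalOp_eq hL]
    linarith [hA.bound_two x, (abs_le.1 (hA.abs_symmOp_le hL x)).1]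
  have habove : BddAbove
      ((fun x => |iteratedDeriv 2 Ψ x| + MixedObstacle.nonlocalOp K Ψ x) '' I) := by
    refine ⟨B + 2 * B * ∫ z, min 1 (z ^ 2) * K z, ?_⟩
    rintro _ ⟨x, -, rfl⟩
    simp only [iteratedDeriv_succ, iteratedDeriv_zero, hB.nonlocalOp_eq hL]
    linarith [hB.bound_two x, (abs_le.1 (hB.abs_symmOp_le hL x)).2]
  refine ⟨fun x _ => ⟨hA.hasPrincipalValue hL x, hB.hasPrincipalValue hL x⟩, hbelow, habove,
    fun φ hφ => ?_⟩
  obtain ⟨C, hC⟩ := hφ.exists_isBoundedC2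
  obtain ⟨U, hU, huU⟩ :=
    MixedObstacle.exists_isBoundedDirichlet_of_mem_admissible hQ hΨ hΦ hu
  refine ⟨⟨hC.hasPrincipalValue hL,
    (MixedObstacle.distribPairing_eq_mixedForm (η := η) hL hU huU hφ).1⟩, fun hφ0 => ⟨?_, ?_⟩⟩
  · set m := min (sInf ((fun x => -|iteratedDeriv 2 Φ x| + MixedObstacle.nonlocalOp K Φ x) '' I))
      (essInf f (volume.restrict I))
    -- In `ℝ`, the a.e. lower bound by `essInf` needs `f` to be essentially bounded below.
    have hbdd : IsBoundedUnder (· ≥ ·) (ae (volume.restrict I)) f :=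
      ⟨_, eventually_map.2 ((ae_le_lpNorm_exponent_top hf).mono fun x hx => (abs_le.1 hx).1)⟩
    -- The upper bound for `-u`, whose lower obstacle is `-Φ`.
    have key := MixedObstacle.distribPairing_le (M := -m) hL hQ.neg hΦ.neg hΨ.neg hη
      hf.neg (MixedObstacle.neg_mem_admissible hu)
      (hvi.neg hL hQ hΨ hΦ hu)
      (fun x hx => by
        have h1 := (min_le_left _ _ : m ≤ _).trans (csInf_le hbelow (mem_image_of_mem _ hx))
        rw [MixedObstacle.nonlocalOp_neg hA hA.neg hL]
        simp only [iteratedDeriv_fun_neg, abs_neg] at h1 ⊢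
        linarith)
      (by
        filter_upwards [ae_essInf_le hbdd] with x hx
        exact neg_le_neg ((min_le_right _ _).trans hx)) hφ hφ0
    have e : MixedObstacle.distribPairing η K (fun x => -u x) φ =
        -MixedObstacle.distribPairing η K u φ := by
      simp only [MixedObstacle.distribPairing, neg_mul, integral_neg]
      ring
    rw [e] at key
    linarith
  · refine MixedObstacle.distribPairing_le hL hQ hΨ hΦ hη hf hu hvi
      (fun x hx => (le_csSup habove (mem_image_of_mem _ hx)).trans (le_max_left _ _)) ?_ hφ hφ0
    have hbdd : IsBoundedUnder (· ≤ ·) (ae (volume.restrict I)) f :=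
      ⟨_, eventually_map.2 ((ae_le_lpNorm_exponent_top hf).mono fun x hx => (abs_le.1 hx).2)⟩
    filter_upwards [ae_le_essSup hbdd] with x hx using hx.trans (le_max_right _ _)
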